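/- Let $d\ge 3$ be an integer. For a connected simple graph $G$ on $n$ labelled vertices, let every unordered pair of distinct vertices exchange one unit of flow, split equally among all geodesics (shortest paths) between the two vertices. For a vertex $v$ let $T(v)$ be the total flow carried by geodesics that contain $v$ (end points included), and let $M(G)=\max_v T(v)$. Let $G_n$ be chosen uniformly at random among all simple $d$-regular graphs on the vertex set $\{1,\dots,n\}$, where $n$ ranges over the integers with $nd$ even and $n>d$. Then there are a real constant $C$ depending only on $d$ and a function $f$ (also depending only on $d$) with $f(n)=o\big(n\log_d^3 n\big)$ such that, with probability tending to $1$ as $n\to\infty$ along those integers, $G_n$ is connected and $M_n=M(G_n)$ satisfies $$M_n\le d^{C}\,n\log_d^3 n+f(n).$$ -/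

import Mathlib

open Filter Topology

/-- The geodesics from `a` to `b` in `G`: the walks whose length is the graph distance.
There are none if `b` is not reachable from `a`. -/
def geodesics {V : Type*} (G : SimpleGraph V) (a b : V) : Set (G.Walk a b) :=
  {p | p.length = G.dist a b}

/-- The part of the unit flow between `a` and `b` that passes through `v` when the flow is split
equally among all geodesics from `a` to `b`; the end points of a geodesic belong to it. -/
noncomputable def flowThrough {V : Type*} (G : SimpleGraph V) (a b v : V) : ℝ :=
  ({p ∈ geodesics G a b | v ∈ p.support}.ncard : ℝ) / ((geodesics G a b).ncard : ℝ)

/-- The total flow `T(v)` through the vertex `v`, where each unordered pair of distinct vertices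
(listed as `a < b`) exchanges one unit of flow. -/
noncomputable def vertexFlow {n : ℕ} (G : SimpleGraph (Fin n)) (v : Fin n) : ℝ :=
  ∑ a : Fin n, ∑ b ∈ Finset.Ioi a, flowThrough G a b v

/-- The maximum vertex flow of `G`. -/
noncomputable def maxVertexFlow {n : ℕ} (G : SimpleGraph (Fin n)) : ℝ :=
  ⨆ v : Fin n, vertexFlow G v

open Classical in
/-- The simple `d`-regular graphs on the vertex set `Fin n`. -/
def regularGraphs (d n : ℕ) : Set (SimpleGraph (Fin n)) :=
  {G | G.IsRegularOfDegree d}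

/-- The probability that a uniformly random `d`-regular graph on `Fin n` has property `P`. -/
noncomputable def regularProb (d n : ℕ) (P : SimpleGraph (Fin n) → Prop) : ℝ :=
  ({G ∈ regularGraphs d n | P G}.ncard : ℝ) / ((regularGraphs d n).ncard : ℝ)

/-- A uniformly random `d`-regular graph has property `P` asymptotically almost surely: the
probability tends to `1` as `n → ∞` through the numbers with `n * d` even. -/
def RegularAAS (d : ℕ) (P : ∀ n : ℕ, SimpleGraph (Fin n) → Prop) : Prop :=
  Tendsto (fun n : ℕ => regularProb d n (P n)) (atTop ⊓ 𝓟 {n : ℕ | Even (n * d)}) (𝓝 1)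

/-! Only an upper bound is needed, so each pair sending geodesics through `v` may be charged a full
unit. If all distances are at most `D`, such a pair `a`, `b` has `dist v a + dist v b ≤ D`. Spheres
in a connected `(m + 1)`-regular graph have at most `2 * m ^ i` vertices, so there are at most `8 *
(D + 1) * m ^ D` such pairs (`maxVertexFlow_le`). Everything thus reduces to showing that with high
probability `D = 2 * R` works, where `m ^ R` is `√n * log n` up to a factor `m`. Then `m ^ D` is
`O(n log² n)`, and `D + 1` supplies the third logarithm. The error term `f` can be taken to be zero.

The distance bound is proved for a uniform pairing of the `n * (m + 1)` half-edges. When the pairing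
is revealed query by query, each live answer is uniform over the free half-edges
(`Adapted.sum_agree`); this yields a supermartingale inequality, and from it a Chernoff bound for
hits on small sets and an exponential bound for missing large sets. Breadth-first exploration from
any vertex rarely runs into itself, so it keeps about `m ^ R` open half-edges (`le_liveCount`). If
two balls of radius `R` stay disjoint, then about `m ^ R` queries each miss a target of about `m ^
R` half-edges. This has probability at most `exp (-c log² n)` for some `c > 0`, which survives a
union bound over pairs of vertices (`card_exists_far_le`).

Finally, the statement passes to simple graphs. Switchings show that a pairing is simple with
probability bounded below (`exists_card_le_card_fewBad`), and every regular graph comes from equally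
many simple pairings (`card_simple_pairings`). Hence an event rare for pairings is rare for random
regular graphs. -/

/-! ### Pairings and their conjugation by transpositions. -/

/-- The perfect matchings of a type, as fixed-point-free involutions. -/
def Pairing (P : Type*) : Type _ :=
  {σ : P → P // (∀ p, σ (σ p) = p) ∧ ∀ p, σ p ≠ p}

namespace Pairing

variable {P : Type*}

instance : CoeFun (Pairing P) (fun _ => P → P) := ⟨Subtype.val⟩

theorem apply_apply (σ : Pairing P) (p : P) : σ (σ p) = p := σ.2.1 p

theorem apply_ne (σ : Pairing P) (p : P) : σ p ≠ p := σ.2.2 p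

theorem injective (σ : Pairing P) : Function.Injective (σ : P → P) := fun p q h => by
  rw [← σ.apply_apply p, h, σ.apply_apply]

theorem apply_eq_comm (σ : Pairing P) {p q : P} : σ p = q ↔ σ q = p :=
  ⟨fun h => by rw [← h, σ.apply_apply], fun h => by rw [← h, σ.apply_apply]⟩

@[ext] theorem ext {σ τ : Pairing P} (h : ∀ p, σ p = τ p) : σ = τ := Subtype.ext (funext h)

/-- Conjugation of a pairing by a permutation. -/
def conj (e : Equiv.Perm P) (σ : Pairing P) : Pairing P :=
  ⟨fun p => e (σ (e.symm p)), fun p => by simp [σ.apply_apply], fun p h =>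
    σ.apply_ne (e.symm p) ((Equiv.eq_symm_apply e).2 h)⟩

noncomputable instance [Fintype P] : Fintype (Pairing P) := by
  classical
  unfold Pairing
  infer_instance

variable [DecidableEq P]

theorem conj_swap_apply (q r : P) (σ : Pairing P) (p : P) :
    conj (Equiv.swap q r) σ p = Equiv.swap q r (σ (Equiv.swap q r p)) := rfl

theorem conj_swap_conj_swap (q r : P) (σ : Pairing P) :
    conj (Equiv.swap q r) (conj (Equiv.swap q r) σ) = σ := by
  ext p
  simp [conj_swap_apply]

end Pairing

/-! ### Adaptive exploration of a uniformly random pairing -/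

section Exploration

variable {P : Type*} (z : Pairing P → ℕ → P)

/-- Two pairings answer the first `t` queries of the exploration `z` in the same way. -/
def Agree (t : ℕ) (σ τ : Pairing P) : Prop :=
  ∀ s < t, σ (z σ s) = τ (z τ s)

/-- Every query of the exploration depends on the earlier answers only. -/
def Adapted : Prop :=
  ∀ t σ τ, Agree z t σ τ → z σ t = z τ t

variable {z} in
theorem Agree.mono {t s : ℕ} {σ τ : Pairing P} (h : Agree z t σ τ) (hs : s ≤ t) :
    Agree z s σ τ := fun i hi => h i (hi.trans_le hs)

variable {z} in
theorem Agree.trans {t : ℕ} {σ τ υ : Pairing P} (h : Agree z t σ τ) (h' : Agree z t τ υ) :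
    Agree z t σ υ := fun i hi => (h i hi).trans (h' i hi)

variable {z} in
theorem Adapted.eq_of_agree (hz : Adapted z) {t s : ℕ} {σ τ : Pairing P} (h : Agree z t σ τ)
    (hs : s ≤ t) : z σ s = z τ s := hz s σ τ (h.mono hs)

variable [DecidableEq P]

/-- The points whose partner is known after `t` queries. -/
def revealed (σ : Pairing P) (t : ℕ) : Finset P :=
  (Finset.range t).image (z σ) ∪ (Finset.range t).image (fun s => σ (z σ s))

/-- The query at time `t` concerns a point whose partner is not known yet. -/
def Live (σ : Pairing P) (t : ℕ) : Prop := z σ t ∉ revealed z σ t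

variable {z}

theorem mem_revealed {σ : Pairing P} {t : ℕ} {p : P} :
    p ∈ revealed z σ t ↔ ∃ s < t, z σ s = p ∨ σ (z σ s) = p := by
  simp only [revealed, Finset.mem_union, Finset.mem_image, Finset.mem_range]
  grind

theorem Adapted.revealed_eq (hz : Adapted z) {t : ℕ} {σ τ : Pairing P} (h : Agree z t σ τ) :
    revealed z σ t = revealed z τ t := by
  ext p
  simp only [mem_revealed]
  refine exists_congr fun s => and_congr_right fun hs => ?_
  rw [hz.eq_of_agree h hs.le, ← h s hs, hz.eq_of_agree h hs.le]

theorem Adapted.live_iff (hz : Adapted z) {t : ℕ} {σ τ : Pairing P} (h : Agree z t σ τ) :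
    Live z σ t ↔ Live z τ t := by
  rw [Live, Live, hz.revealed_eq h, hz t σ τ h]

theorem apply_mem_revealed {σ : Pairing P} {t : ℕ} {p : P} (h : p ∈ revealed z σ t) :
    σ p ∈ revealed z σ t := by
  obtain ⟨s, hs, h | h⟩ := mem_revealed.1 h
  · exact mem_revealed.2 ⟨s, hs, Or.inr (by rw [h])⟩
  · exact mem_revealed.2 ⟨s, hs, Or.inl (by rw [← h, σ.apply_apply])⟩

variable [Fintype P]

variable (z) in
/-- The possible partners of the point queried at time `t`. -/
def free (σ : Pairing P) (t : ℕ) : Finset P :=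
  Finset.univ \ insert (z σ t) (revealed z σ t)

theorem mem_free {σ : Pairing P} {t : ℕ} {p : P} :
    p ∈ free z σ t ↔ p ≠ z σ t ∧ p ∉ revealed z σ t := by
  simp [free]

theorem Adapted.free_eq (hz : Adapted z) {t : ℕ} {σ τ : Pairing P} (h : Agree z t σ τ) :
    free z σ t = free z τ t := by
  rw [free, free, hz.revealed_eq h, hz t σ τ h]

theorem Live.apply_mem_free {σ : Pairing P} {t : ℕ} (h : Live z σ t) : σ (z σ t) ∈ free z σ t :=
  mem_free.2 ⟨σ.apply_ne _, fun h' => h (by simpa [σ.apply_apply] using apply_mem_revealed h')⟩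

theorem card_le_card_free_add (σ : Pairing P) (t : ℕ) :
    Fintype.card P ≤ (free z σ t).card + 2 * t + 1 := by
  have h1 : (revealed z σ t).card ≤ t + t :=
    (Finset.card_union_le _ _).trans (add_le_add (Finset.card_image_le.trans (by simp))
      (Finset.card_image_le.trans (by simp)))
  have h2 := Finset.card_insert_le (z σ t) (revealed z σ t)
  have h3 := Finset.le_card_sdiff (insert (z σ t) (revealed z σ t)) Finset.univ
  rw [Finset.card_univ] at h3
  simp only [free]
  omega

/-- The transposition fixes every revealed point, so no answer given so far changes; by adaptedness
the queries do not change either. This symmetry is the source of the uniformity of the next answer.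
-/
theorem Adapted.agree_conj_swap (hz : Adapted z) {t : ℕ} {σ : Pairing P} {q r : P}
    (hq : q ∈ free z σ t) (hr : r ∈ free z σ t) :
    Agree z t σ (Pairing.conj (Equiv.swap q r) σ) := by
  have hne : ∀ s < t, ∀ p, z σ s = p ∨ σ (z σ s) = p → Equiv.swap q r p = p := fun s hs p hp => by
    have hp' : p ∈ revealed z σ t := mem_revealed.2 ⟨s, hs, hp⟩
    refine Equiv.swap_apply_of_ne_of_ne ?_ ?_
    · rintro rfl; exact (mem_free.1 hq).2 hp'
    · rintro rfl; exact (mem_free.1 hr).2 hp'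
  intro s
  induction s using Nat.strong_induction_on with
  | _ s ih =>
    intro hs
    have h : Agree z s σ (Pairing.conj (Equiv.swap q r) σ) := fun i hi => ih i hi (hi.trans hs)
    rw [← hz s _ _ h, Pairing.conj_swap_apply, hne s hs _ (Or.inl rfl), hne s hs _ (Or.inr rfl)]

open Classical in
/-- Given the answers to the first `t` queries, the answer to a live query is uniformly distributed
over the possible partners. -/
theorem Adapted.sum_agree (hz : Adapted z) {t : ℕ} {σ : Pairing P} (hσ : Live z σ t) (g : P → ℝ) :
    ((free z σ t).card : ℝ) * ∑ τ with Agree z t σ τ, g (τ (z τ t)) =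
      ((Finset.univ.filter (fun τ => Agree z t σ τ)).card : ℝ) * ∑ q ∈ free z σ t, g q := by
  set X := Finset.univ.filter (fun τ => Agree z t σ τ) with hX
  have hmem : ∀ τ, τ ∈ X ↔ Agree z t σ τ := fun τ => by simp [hX]
  have hmaps : ∀ τ ∈ X, τ (z τ t) ∈ free z σ t := fun τ hτ => by
    rw [hz.free_eq ((hmem τ).1 hτ)]
    exact ((hz.live_iff ((hmem τ).1 hτ)).1 hσ).apply_mem_free
  set c : P → ℕ := fun q => (X.filter (fun τ => τ (z τ t) = q)).card with hc
  -- Conjugating by the transposition of `q` and `r` injects the pairings that answer `q` into those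
  -- that answer `r`, without changing the history.
  have hle : ∀ q ∈ free z σ t, ∀ r ∈ free z σ t, c q ≤ c r := by
    intro q hq r hr
    refine Finset.card_le_card_of_injOn (Pairing.conj (Equiv.swap q r)) ?_ ?_
    · intro τ hτ
      have hτ := Finset.mem_filter.1 hτ
      have hA := (hmem τ).1 hτ.1
      have hB := hz.agree_conj_swap (hz.free_eq hA ▸ hq) (hz.free_eq hA ▸ hr)
      refine Finset.mem_coe.2 (Finset.mem_filter.2 ⟨(hmem _).2 (hA.trans hB), ?_⟩)
      have hne1 : z τ t ≠ q := fun h => (mem_free.1 (hz.free_eq hA ▸ hq)).1 h.symm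
      have hne2 : z τ t ≠ r := fun h => (mem_free.1 (hz.free_eq hA ▸ hr)).1 h.symm
      rw [← hz t _ _ hB, Pairing.conj_swap_apply, Equiv.swap_apply_of_ne_of_ne hne1 hne2, hτ.2,
        Equiv.swap_apply_left]
    · intro τ _ τ' _ h
      have h := congrArg (Pairing.conj (Equiv.swap q r)) h
      rwa [Pairing.conj_swap_conj_swap, Pairing.conj_swap_conj_swap] at h
  have hsum : ∀ f : P → ℝ, ∑ τ ∈ X, f (τ (z τ t)) = ∑ q ∈ free z σ t, (c q : ℝ) * f q := by
    intro f
    rw [← Finset.sum_fiberwise_of_maps_to hmaps]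
    refine Finset.sum_congr rfl fun q _ => ?_
    rw [Finset.sum_congr rfl (g := fun _ => f q) fun τ hτ => by rw [(Finset.mem_filter.1 hτ).2]]
    simp [hc]
  have h0 := hσ.apply_mem_free
  set q₀ := σ (z σ t)
  have hcst : ∀ q ∈ free z σ t, c q = c q₀ := fun q hq =>
    le_antisymm (hle q hq _ h0) (hle _ h0 q hq)
  have hsum' : ∀ f : P → ℝ, ∑ τ ∈ X, f (τ (z τ t)) = c q₀ * ∑ q ∈ free z σ t, f q := by
    intro f
    rw [hsum, Finset.mul_sum]
    exact Finset.sum_congr rfl fun q hq => by rw [hcst q hq]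
  have h1 : (X.card : ℝ) = c q₀ * (free z σ t).card := by simpa using hsum' (fun _ => 1)
  rw [hsum', h1]
  ring

open Classical in
/-- A product of adapted factors whose conditional expectations are at most `1` has expectation at
most `1`. -/
theorem Adapted.sum_prod_le_card (hz : Adapted z) (g : ℕ → Pairing P → P → ℝ) (T : ℕ)
    (hg0 : ∀ t σ q, 0 ≤ g t σ q) (hg : ∀ t σ τ, Agree z t σ τ → g t σ = g t τ)
    (hlive : ∀ t < T, ∀ σ, Live z σ t → ∑ q ∈ free z σ t, g t σ q ≤ (free z σ t).card)
    (hdead : ∀ t < T, ∀ σ, ¬ Live z σ t → ∀ q, g t σ q ≤ 1) :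
    ∑ σ : Pairing P, ∏ t ∈ Finset.range T, g t σ (σ (z σ t)) ≤ Fintype.card (Pairing P) := by
  induction T with
  | zero => simp
  | succ T ih =>
    refine le_trans ?_ (ih (fun t ht => hlive t (ht.trans T.lt_succ_self))
      (fun t ht => hdead t (ht.trans T.lt_succ_self)))
    -- Condition on the history `H` of the first `T` answers. On each fibre the earlier factors have
    -- a constant product, and only the average of the last factor matters.
    set H : Pairing P → (Fin T → P) := fun σ s => σ (z σ s) with hH
    have hAg : ∀ σ τ, H τ = H σ ↔ Agree z T σ τ := fun σ τ =>
      ⟨fun h s hs => (congrFun h ⟨s, hs⟩).symm, fun h => funext fun s => (h s s.2).symm⟩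
    rw [← Finset.sum_fiberwise (s := Finset.univ) (g := H),
      ← Finset.sum_fiberwise (s := Finset.univ) (g := H)]
    refine Finset.sum_le_sum fun h _ => ?_
    by_cases hne : ∃ σ, H σ = h
    swap
    · rw [Finset.filter_false_of_mem fun σ _ h' => hne ⟨σ, h'⟩]; simp
    obtain ⟨σ, rfl⟩ := hne
    simp only [hAg]
    set M := ∏ t ∈ Finset.range T, g t σ (σ (z σ t)) with hM
    have hMτ : ∀ τ ∈ Finset.univ.filter (fun τ => Agree z T σ τ),
        ∏ t ∈ Finset.range T, g t τ (τ (z τ t)) = M := fun τ hτ => by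
      have hτ := (Finset.mem_filter.1 hτ).2
      refine Finset.prod_congr rfl fun t ht => ?_
      have ht := Finset.mem_range.1 ht
      rw [← hg t _ _ (hτ.mono ht.le), hτ t ht]
    have hM0 : 0 ≤ M := Finset.prod_nonneg fun t _ => hg0 _ _ _
    rw [Finset.sum_congr rfl hMτ]
    have : ∀ τ ∈ Finset.univ.filter (fun τ => Agree z T σ τ),
        ∏ t ∈ Finset.range (T + 1), g t τ (τ (z τ t)) = M * g T σ (τ (z τ T)) := fun τ hτ => by
      rw [Finset.prod_range_succ, hMτ τ hτ, ← hg T _ _ (Finset.mem_filter.1 hτ).2]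
    rw [Finset.sum_congr rfl this, ← Finset.mul_sum, Finset.sum_const, nsmul_eq_mul, mul_comm _ M]
    refine mul_le_mul_of_nonneg_left ?_ hM0
    by_cases hl : Live z σ T
    · have hpos : (0 : ℝ) < (free z σ T).card := by
        exact_mod_cast Finset.card_pos.2 ⟨_, hl.apply_mem_free⟩
      have h1 := hz.sum_agree hl (g T σ)
      have h2 := hlive T T.lt_succ_self σ hl
      refine le_of_mul_le_mul_left (h1.trans_le ?_) hpos
      rw [mul_comm]
      exact mul_le_mul_of_nonneg_right h2 (Nat.cast_nonneg _)
    · refine (Finset.sum_le_sum fun τ _ => hdead T T.lt_succ_self σ hl _).trans ?_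
      simp

open Classical in
/-- A Chernoff bound for the number of live queries whose answer lies in a small bad set. -/
theorem Adapted.card_badSteps_le (hz : Adapted z) (B : ℕ → Pairing P → Finset P)
    (hB : ∀ t σ τ, Agree z t σ τ → B t σ = B t τ) {T b k : ℕ} {u : ℝ} (hu : 0 < u) (hb : 0 < b)
    (hT : 0 < T) (hk : 0 < k)
    (hcard : ∀ t < T, ∀ σ, (B t σ).card ≤ b) (huN : u + 2 * T ≤ Fintype.card P) :
    ((Finset.univ.filter (fun σ : Pairing P => k ≤
      ((Finset.range T).filter (fun t => Live z σ t ∧ σ (z σ t) ∈ B t σ)).card)).card : ℝ) ≤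
      (Real.exp 1 * b * T / (k * u)) ^ k * Fintype.card (Pairing P) := by
  have hb' : (0 : ℝ) < b := by exact_mod_cast hb
  have hT' : (0 : ℝ) < T := by exact_mod_cast hT
  have hk' : (0 : ℝ) < k := by exact_mod_cast hk
  -- The weight `l` per bad answer minimises the exponential-moment bound `l ^ (-k) * exp (l * b * T
  -- / u)`. The minimum is `(exp 1 / l) ^ k`, which is trivial when `l < 1`.
  set l : ℝ := k * u / (b * T) with hl
  have hl0 : 0 < l := by positivity
  have hbase : Real.exp 1 * b * T / (k * u) = Real.exp 1 / l := by
    rw [hl]; field_simp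
  rw [hbase]
  rcases lt_or_ge l 1 with h1 | h1
  · have : (1 : ℝ) ≤ (Real.exp 1 / l) ^ k := by
      refine one_le_pow₀ ((one_le_div hl0).2 (h1.le.trans (Real.one_le_exp zero_le_one)))
    refine le_trans ?_ (le_mul_of_one_le_left (Nat.cast_nonneg _) this)
    exact_mod_cast Finset.card_le_univ _
  -- At least `u` partners are free and at most `b` are bad, so the weights average at most `1 + c ≤
  -- exp c`; the factor `exp (-c)` normalises this. Over `T` steps the normalisation costs `exp
  -- (-k)`, since `c * T = k`.
  set c : ℝ := l * b / u with hc
  have hc0 : 0 < c := by positivity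
  set g : ℕ → Pairing P → P → ℝ := fun t σ q =>
    (if Live z σ t ∧ q ∈ B t σ then l else 1) * Real.exp (-c) with hg
  have key := hz.sum_prod_le_card g T (fun t σ q => by simp only [hg]; split_ifs <;> positivity)
    (fun t σ τ h => by
      funext q
      simp only [hg, hB t σ τ h, hz.live_iff h]) (fun t ht σ hlv => by
      have hfree : u ≤ (free z σ t).card := by
        have h1 := card_le_card_free_add (z := z) σ t
        have h2 : (Fintype.card P : ℝ) ≤ (free z σ t).card + 2 * t + 1 := by exact_mod_cast h1
        have h3 : (t : ℝ) + 1 ≤ T := by exact_mod_cast ht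
        linarith
      have h4 : ∑ q ∈ free z σ t, (if Live z σ t ∧ q ∈ B t σ then l else 1) ≤
          (free z σ t).card + l * b := by
        have : ∀ q ∈ free z σ t, (if Live z σ t ∧ q ∈ B t σ then l else 1) ≤
            1 + if q ∈ B t σ then l else 0 := fun q _ => by
          by_cases hq : q ∈ B t σ <;> simp [hq, hlv]
        refine (Finset.sum_le_sum this).trans ?_
        rw [Finset.sum_add_distrib, ← Finset.sum_filter]
        simp only [Finset.sum_const, nsmul_eq_mul, mul_one]
        have h5 : (((free z σ t).filter (fun q => q ∈ B t σ)).card : ℝ) ≤ b := by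
          exact_mod_cast (Finset.card_le_card fun q hq => (Finset.mem_filter.1 hq).2).trans
            (hcard t ht σ)
        nlinarith
      simp only [hg]
      rw [← Finset.sum_mul]
      refine (mul_le_mul_of_nonneg_right h4 (Real.exp_pos _).le).trans ?_
      have h6 : ((free z σ t).card : ℝ) + l * b ≤ (free z σ t).card * (1 + c) := by
        have : l * b = u * c := by rw [hc]; field_simp
        nlinarith
      have h7 : 1 + c ≤ Real.exp c := by linarith [Real.add_one_le_exp c]
      calc ((free z σ t).card + l * b) * Real.exp (-c)
          ≤ ((free z σ t).card * Real.exp c) * Real.exp (-c) := by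
            refine mul_le_mul_of_nonneg_right (h6.trans ?_) (Real.exp_pos _).le
            exact mul_le_mul_of_nonneg_left h7 (Nat.cast_nonneg _)
        _ = (free z σ t).card := by rw [mul_assoc, ← Real.exp_add]; simp)
    (fun t _ σ hd q => by
      simp only [hg, hd, false_and, if_false, one_mul]
      exact Real.exp_le_one_iff.2 (by linarith))
  set Y := Finset.univ.filter (fun σ : Pairing P => k ≤
      ((Finset.range T).filter (fun t => Live z σ t ∧ σ (z σ t) ∈ B t σ)).card)
  have hprod : ∀ σ, ∏ t ∈ Finset.range T, g t σ (σ (z σ t)) =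
      l ^ ((Finset.range T).filter (fun t => Live z σ t ∧ σ (z σ t) ∈ B t σ)).card *
        Real.exp (-c) ^ T := fun σ => by
    simp only [hg, Finset.prod_mul_distrib, Finset.prod_ite, Finset.prod_const, one_pow, mul_one,
      Finset.card_range]
  have h8 : (Y.card : ℝ) * (l ^ k * Real.exp (-c) ^ T) ≤ Fintype.card (Pairing P) := by
    refine le_trans ?_ key
    rw [← nsmul_eq_mul, ← Finset.sum_const]
    refine (Finset.sum_le_sum fun σ hσ => ?_).trans
      (Finset.sum_le_univ_sum_of_nonneg fun σ => Finset.prod_nonneg fun t _ => ?_)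
    · rw [hprod]
      exact mul_le_mul_of_nonneg_right (pow_le_pow_right₀ h1 (Finset.mem_filter.1 hσ).2)
        (by positivity)
    · simp only [hg]; split_ifs <;> positivity
  have h9 : l ^ k * Real.exp (-c) ^ T = (l / Real.exp 1) ^ k := by
    have : c * T = k := by rw [hc, hl]; field_simp
    rw [← Real.exp_nat_mul, div_pow l, ← Real.exp_nat_mul, div_eq_mul_inv (l ^ k), ← Real.exp_neg]
    congr 2
    linarith
  rw [h9] at h8
  have h10 : (Real.exp 1 / l) ^ k = ((l / Real.exp 1) ^ k)⁻¹ := by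
    rw [← inv_pow, inv_div]
  rw [h10, inv_mul_eq_div, le_div_iff₀ (by positivity)]
  exact h8

open Classical in
/-- It is unlikely that many queries avoid large target sets. -/
theorem Adapted.card_avoid_le (hz : Adapted z) (F : ℕ → Pairing P → Finset P)
    (good : ℕ → Pairing P → Prop)
    (hF : ∀ t σ τ, Agree z t σ τ → F t σ = F t τ)
    (hgood : ∀ t σ τ, Agree z t σ τ → (good t σ ↔ good t τ)) {T : ℕ} {k ρ : ℝ} (hρ : ρ < 1)
    (hρ0 : 0 ≤ ρ)
    (h : ∀ t < T, ∀ σ, good t σ → Live z σ t ∧ F t σ ⊆ free z σ t ∧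
      ρ * Fintype.card P ≤ (F t σ).card) :
    ((Finset.univ.filter (fun σ : Pairing P =>
      k ≤ ((Finset.range T).filter (fun t => good t σ)).card ∧
        ∀ t < T, good t σ → σ (z σ t) ∉ F t σ)).card : ℝ) ≤
      Real.exp (-(ρ * k)) * Fintype.card (Pairing P) := by
  have hρ1 : 0 < 1 - ρ := by linarith
  -- A hit kills the product and a miss multiplies it by `(1 - ρ)⁻¹`. The average is at most one
  -- because the target contains at least the fraction `ρ` of the free points; surviving `k` good
  -- steps makes the product at least `exp (ρ * k)`.
  set g : ℕ → Pairing P → P → ℝ := fun t σ q =>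
    if good t σ ∧ t < T then (if q ∈ F t σ then 0 else (1 - ρ)⁻¹) else 1 with hg
  have hg0 : ∀ t σ q, 0 ≤ g t σ q := fun t σ q => by simp only [hg]; split_ifs <;> positivity
  have key := hz.sum_prod_le_card g T hg0
    (fun t σ τ h => by
      funext q
      simp only [hg, hF t σ τ h, hgood t σ τ h]) (fun t ht σ hlv => by
      by_cases hgd : good t σ
      · obtain ⟨-, h2, h3⟩ := h t ht σ hgd
        simp only [hg, hgd, ht, and_self, if_true]
        have e1 : ∑ q ∈ free z σ t, (if q ∈ F t σ then 0 else (1 - ρ)⁻¹) =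
            ((free z σ t).card - (F t σ).card) * (1 - ρ)⁻¹ := by
          rw [Finset.sum_ite]
          simp only [Finset.sum_const_zero, zero_add, Finset.sum_const, nsmul_eq_mul]
          rw [← Finset.sdiff_eq_filter, Finset.card_sdiff_of_subset h2,
            Nat.cast_sub (Finset.card_le_card h2)]
        rw [e1, ← div_eq_mul_inv, div_le_iff₀ hρ1]
        have h4 : ((free z σ t).card : ℝ) ≤ Fintype.card P := by
          exact_mod_cast Finset.card_le_univ _
        nlinarith
      · simp [hg, hgd]) (fun t ht σ hd q => by
      have : ¬ good t σ := fun hgd => hd (h t ht σ hgd).1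
      simp [hg, this])
  set Y := Finset.univ.filter (fun σ : Pairing P =>
      k ≤ ((Finset.range T).filter (fun t => good t σ)).card ∧
        ∀ t < T, good t σ → σ (z σ t) ∉ F t σ)
  have hexp : Real.exp ρ ≤ (1 - ρ)⁻¹ := by
    rw [le_inv_comm₀ (Real.exp_pos _) hρ1, ← Real.exp_neg]
    linarith [Real.add_one_le_exp (-ρ)]
  have h8 : (Y.card : ℝ) * Real.exp (ρ * k) ≤ Fintype.card (Pairing P) := by
    refine le_trans ?_ key
    rw [← nsmul_eq_mul, ← Finset.sum_const]
    refine (Finset.sum_le_sum fun σ hσ => ?_).trans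
      (Finset.sum_le_univ_sum_of_nonneg fun σ => Finset.prod_nonneg fun t _ => hg0 _ _ _)
    obtain ⟨h1, h2⟩ := (Finset.mem_filter.1 hσ).2
    have : ∀ t ∈ Finset.range T, g t σ (σ (z σ t)) = if good t σ then (1 - ρ)⁻¹ else 1 :=
      fun t ht => by
        have ht := Finset.mem_range.1 ht
        by_cases hgd : good t σ
        · simp [hg, hgd, ht, h2 t ht hgd]
        · simp [hg, hgd]
    rw [Finset.prod_congr rfl this, Finset.prod_ite]
    simp only [Finset.prod_const, one_pow, mul_one]
    refine le_trans ?_ (pow_le_pow_left₀ (Real.exp_pos _).le hexp _)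
    rw [← Real.exp_nat_mul, mul_comm]
    exact Real.exp_le_exp.2 (mul_le_mul_of_nonneg_right h1 hρ0)
  rw [Real.exp_neg, inv_mul_eq_div, le_div_iff₀ (Real.exp_pos _)]
  exact h8

end Exploration

/-- The simple graph underlying a pairing of the half-edges `V × ι`. -/
def Pairing.graph {V ι : Type*} (σ : Pairing (V × ι)) : SimpleGraph V where
  Adj u v := u ≠ v ∧ ∃ i, (σ (u, i)).1 = v
  symm := ⟨by
    rintro u v ⟨h, i, hi⟩
    refine ⟨h.symm, (σ (u, i)).2, ?_⟩
    have : (v, (σ (u, i)).2) = σ (u, i) := by rw [← hi]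
    rw [this, σ.apply_apply]⟩
  loopless := ⟨fun _ h => h.1 rfl⟩

/-! ### Breadth-first exploration of a pairing from a vertex -/

section Explore

variable {V : Type*} {m : ℕ}

/-- The half-edges met by the non-backtracking walks that start in `a`, in breadth-first order; the
children of the index `t` are the indices `m + 1 + m * t + j` with `j < m`. -/
def explore (a : V) (σ : Pairing (V × Fin (m + 1))) (t : ℕ) : V × Fin (m + 1) :=
  if h : t < m + 1 then (a, ⟨t, h⟩)
  else
    ((σ (explore a σ ((t - (m + 1)) / m))).1,
      (σ (explore a σ ((t - (m + 1)) / m))).2 + Fin.ofNat (m + 1) ((t - (m + 1)) % m + 1))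
termination_by t
decreasing_by
  all_goals
    have := Nat.div_le_self (t - (m + 1)) m
    omega

theorem explore_of_lt (a : V) (σ : Pairing (V × Fin (m + 1))) {t : ℕ} (h : t < m + 1) :
    explore a σ t = (a, ⟨t, h⟩) := by
  rw [explore, dif_pos h]

theorem explore_child (a : V) (σ : Pairing (V × Fin (m + 1))) (t : ℕ) {j : ℕ} (h : j < m) :
    explore a σ (m + 1 + m * t + j) =
      ((σ (explore a σ t)).1, (σ (explore a σ t)).2 + Fin.ofNat (m + 1) (j + 1)) := by
  have h1 : m + 1 + m * t + j - (m + 1) = j + m * t := by omega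
  have h2 : (j + m * t) / m = t := by
    rw [Nat.add_mul_div_left _ _ (by omega), Nat.div_eq_of_lt h, zero_add]
  have h3 : (j + m * t) % m = j := by rw [Nat.add_mul_mod_self_left, Nat.mod_eq_of_lt h]
  rw [explore, dif_neg (by omega), h1, h2, h3]

theorem lt_or_eq_child (hm : 0 < m) (t : ℕ) :
    t < m + 1 ∨ ∃ u j, j < m ∧ t = m + 1 + m * u + j := by
  rcases lt_or_ge t (m + 1) with h | h
  · exact Or.inl h
  · refine Or.inr ⟨(t - (m + 1)) / m, (t - (m + 1)) % m, Nat.mod_lt _ hm, ?_⟩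
    have := Nat.div_add_mod (t - (m + 1)) m
    omega

theorem lt_child (hm : 0 < m) (u j : ℕ) : u < m + 1 + m * u + j := by
  nlinarith

theorem ofNat_succ_inj {i j : ℕ} (hi : i < m) (hj : j < m)
    (h : Fin.ofNat (m + 1) (i + 1) = Fin.ofNat (m + 1) (j + 1)) : i = j := by
  have := congrArg Fin.val h
  simp only [Fin.ofNat] at this
  rw [Nat.mod_eq_of_lt (by omega), Nat.mod_eq_of_lt (by omega)] at this
  omega

theorem ofNat_succ_ne_zero {j : ℕ} (hj : j < m) : Fin.ofNat (m + 1) (j + 1) ≠ 0 := by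
  intro h
  have := congrArg Fin.val h
  simp only [Fin.ofNat] at this
  rw [Nat.mod_eq_of_lt (by omega)] at this
  simp at this

theorem adapted_explore (hm : 0 < m) (a : V) :
    Adapted (fun (σ : Pairing (V × Fin (m + 1))) t => explore a σ t) := by
  intro t σ τ h
  rcases lt_or_eq_child hm t with ht | ⟨u, j, hj, rfl⟩
  · simp only [explore_of_lt _ _ ht]
  · simp only [explore_child _ _ _ hj]
    rw [h u (lt_child hm u j)]

variable [DecidableEq V]

/-- The vertices met by the exploration before the step `t`. -/
def seen (a : V) (σ : Pairing (V × Fin (m + 1))) (t : ℕ) : Finset V :=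
  insert a ((Finset.range t).image fun s => (σ (explore a σ s)).1)

theorem mem_seen {a v : V} {σ : Pairing (V × Fin (m + 1))} {t : ℕ} :
    v ∈ seen a σ t ↔ v = a ∨ ∃ s < t, (σ (explore a σ s)).1 = v := by
  simp [seen]

theorem card_seen_le (a : V) (σ : Pairing (V × Fin (m + 1))) (t : ℕ) :
    (seen a σ t).card ≤ t + 1 :=
  (Finset.card_insert_le _ _).trans (Nat.succ_le_succ (Finset.card_image_le.trans (by simp)))

theorem seen_eq_of_agree {a : V} {σ τ : Pairing (V × Fin (m + 1))} {t : ℕ}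
    (h : Agree (explore a) t σ τ) : seen a σ t = seen a τ t := by
  ext v
  simp only [mem_seen]
  refine or_congr_right (exists_congr fun s => and_congr_right fun hs => ?_)
  rw [h s hs]

/-- The step `t` of the exploration queries a new half-edge and finds a known vertex. -/
def Collision (a : V) (σ : Pairing (V × Fin (m + 1))) (t : ℕ) : Prop :=
  Live (explore a) σ t ∧ (σ (explore a σ t)).1 ∈ seen a σ t

open Classical in
/-- The number of collisions in the first `T` steps. -/
noncomputable def collCount (a : V) (σ : Pairing (V × Fin (m + 1))) (T : ℕ) : ℕ :=
  ((Finset.range T).filter (Collision a σ)).card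

open Classical in
/-- The number of live steps among the first `T` steps. -/
noncomputable def liveCount (a : V) (σ : Pairing (V × Fin (m + 1))) (T : ℕ) : ℕ :=
  ((Finset.range T).filter (Live (explore a) σ)).card

/-- The index `t` is an initial one, or its parent discovers a new vertex. -/
def Proper (a : V) (σ : Pairing (V × Fin (m + 1))) (t : ℕ) : Prop :=
  t < m + 1 ∨ ∃ u j, j < m ∧ t = m + 1 + m * u + j ∧ (σ (explore a σ u)).1 ∉ seen a σ u

/-- The vertex of a proper index is either the root or discovered first by the parent. Earlier
occurrences could therefore only be siblings, which carry other labels, since children of later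
parents have larger indices. -/
theorem Proper.explore_ne (hm : 0 < m) {a : V} {σ : Pairing (V × Fin (m + 1))} {t t' : ℕ}
    (h : Proper a σ t) (ht' : t' < t) : explore a σ t' ≠ explore a σ t := by
  intro he
  rcases h with h | ⟨u, j, hj, rfl, hu⟩
  · rw [explore_of_lt _ _ h, explore_of_lt _ _ (ht'.trans h)] at he
    simp at he
    omega
  · rw [explore_child _ _ _ hj] at he
    rcases lt_or_eq_child hm t' with h' | ⟨u', j', hj', rfl⟩
    · rw [explore_of_lt _ _ h'] at he
      exact hu (mem_seen.2 (Or.inl (congrArg Prod.fst he).symm))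
    · rw [explore_child _ _ _ hj'] at he
      rcases lt_trichotomy u' u with h1 | rfl | h1
      · exact hu (mem_seen.2 (Or.inr ⟨u', h1, (Prod.mk.inj he).1⟩))
      · have := ofNat_succ_inj hj' hj (add_left_cancel (congrArg Prod.snd he))
        omega
      · have : m * (u + 1) ≤ m * u' := Nat.mul_le_mul_left _ h1
        rw [mul_add] at this
        omega

/-- A proper half-edge has not been queried before, so if dead it was an earlier answer. At the
first step giving this answer its vertex was already seen: it is the root, or it was discovered by
the parent. The parent's own answer is excluded because children have nonzero offset. -/
theorem Proper.exists_collision (hm : 0 < m) {a : V} {σ : Pairing (V × Fin (m + 1))} {t : ℕ}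
    (h : Proper a σ t) (hd : ¬ Live (explore a) σ t) :
    ∃ s < t, Collision a σ s ∧ σ (explore a σ s) = explore a σ t := by
  classical
  have hd := mem_revealed.1 (not_not.1 hd)
  obtain ⟨hst, hs⟩ := Nat.find_spec hd
  have hmin : ∀ u < Nat.find hd, ¬ (explore a σ u = explore a σ t ∨
      σ (explore a σ u) = explore a σ t) := fun u hu h' => Nat.find_min hd hu ⟨hu.trans hst, h'⟩
  set s := Nat.find hd
  have hs : σ (explore a σ s) = explore a σ t := hs.resolve_left (h.explore_ne hm hst)
  refine ⟨s, hst, ⟨fun hr => ?_, ?_⟩, hs⟩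
  · obtain ⟨u, hu, h1 | h1⟩ := mem_revealed.1 hr
    · exact hmin u hu (Or.inr (by rw [h1, hs]))
    · exact hmin u hu (Or.inl (by rw [← hs, ← h1, σ.apply_apply]))
  · rcases h with h | ⟨u, j, hj, rfl, hu⟩
    · rw [hs, explore_of_lt _ _ h]
      exact mem_seen.2 (Or.inl rfl)
    · have hst' : (σ (explore a σ s)).1 = (σ (explore a σ u)).1 := by
        rw [hs, explore_child _ _ _ hj]
      rcases lt_trichotomy u s with h1 | h1 | h1
      · exact mem_seen.2 (Or.inr ⟨u, h1, hst'.symm⟩)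
      · rw [explore_child _ _ _ hj, h1] at hs
        exact absurd (left_eq_add.1 (congrArg Prod.snd hs)) (ofNat_succ_ne_zero hj)
      · exact absurd (mem_seen.2 (Or.inr ⟨s, h1, hst'⟩)) hu

open Classical in
theorem liveCount_add_card_dead (a : V) (σ : Pairing (V × Fin (m + 1))) (T : ℕ) :
    liveCount a σ T + ((Finset.range T).filter (fun t => ¬ Live (explore a) σ t)).card = T := by
  rw [liveCount, Finset.card_filter_add_card_filter_not, Finset.card_range]

open Classical in
-- Improper indices are children of dead or colliding indices, `m` for each. Proper dead indices
-- inject into collisions, since distinct proper indices carry distinct half-edges.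
theorem card_dead_le (hm : 0 < m) (a : V) (σ : Pairing (V × Fin (m + 1))) (T : ℕ) :
    ((Finset.range (m + 1 + m * T)).filter (fun t => ¬ Live (explore a) σ t)).card ≤
      m * (((Finset.range T).filter (fun t => ¬ Live (explore a) σ t)).card + collCount a σ T) +
        collCount a σ (m + 1 + m * T) := by
  set D := (Finset.range T).filter (fun t => ¬ Live (explore a) σ t)
  set C := (Finset.range T).filter (Collision a σ)
  set T' := m + 1 + m * T
  set E := (Finset.range T').filter (fun t => Proper a σ t ∧ ¬ Live (explore a) σ t) with hE
  have hsub : (Finset.range T').filter (fun t => ¬ Live (explore a) σ t) ⊆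
      ((D ∪ C) ×ˢ Finset.range m).image (fun p => m + 1 + m * p.1 + p.2) ∪ E := by
    intro t ht
    obtain ⟨h1, h2⟩ := Finset.mem_filter.1 ht
    rw [Finset.mem_union]
    by_cases hp : Proper a σ t
    · exact Or.inr (Finset.mem_filter.2 ⟨h1, hp, h2⟩)
    · left
      rcases lt_or_eq_child hm t with h3 | ⟨u, j, hj, rfl⟩
      · exact absurd (Or.inl h3) hp
      · refine Finset.mem_image.2 ⟨(u, j), Finset.mem_product.2 ⟨?_, Finset.mem_range.2 hj⟩, rfl⟩
        have hu : u < T := by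
          have := Finset.mem_range.1 h1
          refine Nat.lt_of_mul_lt_mul_left (a := m) ?_
          omega
        have hs : (σ (explore a σ u)).1 ∈ seen a σ u := by
          by_contra hs
          exact hp (Or.inr ⟨u, j, hj, rfl, hs⟩)
        rw [Finset.mem_union, Finset.mem_filter, Finset.mem_filter, Finset.mem_range]
        by_cases hl : Live (explore a) σ u
        · exact Or.inr ⟨hu, hl, hs⟩
        · exact Or.inl ⟨hu, hl⟩
  have hEcard : E.card ≤ collCount a σ T' := by
    have : ∀ t ∈ E, ∃ s < t, Collision a σ s ∧ σ (explore a σ s) = explore a σ t := fun t ht =>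
      (Finset.mem_filter.1 ht).2.1.exists_collision hm (Finset.mem_filter.1 ht).2.2
    choose! f hf using this
    refine Finset.card_le_card_of_injOn f (fun t ht => ?_) (fun t ht t' ht' h => ?_)
    · obtain ⟨h1, h2, -⟩ := hf t ht
      exact Finset.mem_coe.2 (Finset.mem_filter.2 ⟨Finset.mem_range.2
        (h1.trans (Finset.mem_range.1 (Finset.mem_filter.1 ht).1)), h2⟩)
    · have he : explore a σ t = explore a σ t' := by rw [← (hf t ht).2.2, h, (hf t' ht').2.2]
      rcases lt_trichotomy t t' with h1 | h1 | h1
      · exact absurd he ((Finset.mem_filter.1 ht').2.1.explore_ne hm h1)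
      · exact h1
      · exact absurd he.symm ((Finset.mem_filter.1 ht).2.1.explore_ne hm h1)
  refine (Finset.card_le_card hsub).trans ((Finset.card_union_le _ _).trans ?_)
  refine add_le_add (Finset.card_image_le.trans ?_) hEcard
  rw [Finset.card_product, Finset.card_range, mul_comm]
  exact Nat.mul_le_mul_left _ (Finset.card_union_le _ _)

/-- The complementary form of `card_dead_le`: up to collisions, each live index has `m` live
children, and the root contributes `m + 1` more. -/
theorem mul_liveCount_add_le (hm : 0 < m) (a : V) (σ : Pairing (V × Fin (m + 1))) (T : ℕ) :
    m * liveCount a σ T + (m + 1) ≤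
      liveCount a σ (m + 1 + m * T) + m * collCount a σ T + collCount a σ (m + 1 + m * T) := by
  have h1 := card_dead_le hm a σ T
  have h2 := liveCount_add_card_dead a σ T
  have h3 := liveCount_add_card_dead a σ (m + 1 + m * T)
  rw [mul_add] at h1
  have h4 := congrArg (m * ·) h2
  simp only [mul_add] at h4
  omega

/-- The number of indices of the exploration of depth less than `r`. -/
def levelEnd (m : ℕ) : ℕ → ℕ
  | 0 => 0
  | r + 1 => m + 1 + m * levelEnd m r

theorem levelEnd_add_le (hm : 2 ≤ m) (r : ℕ) : levelEnd m r + 3 ≤ 3 * m ^ r := by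
  induction r with
  | zero => simp [levelEnd]
  | succ r ih =>
    have := Nat.mul_le_mul_left m ih
    rw [levelEnd, pow_succ]
    nlinarith

/-- If collisions are rare, then the exploration finds many half-edges. -/
theorem le_liveCount (hm : 2 ≤ m) (a : V) (σ : Pairing (V × Fin (m + 1))) (R : ℕ)
    (h : ∀ r, 1 ≤ r → r ≤ R → (collCount a σ (levelEnd m r) : ℝ) ≤ 1 + √m ^ r / 24) {r : ℕ}
    (hr : 1 ≤ r) (hrR : r ≤ R) :
    (m : ℝ) ^ r / 2 + √m ^ r / 4 ≤ liveCount a σ (levelEnd m r) := by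
  set s := √(m : ℝ)
  have hs2 : s * s = m := Real.mul_self_sqrt (Nat.cast_nonneg _)
  have hm' : (2 : ℝ) ≤ m := by exact_mod_cast hm
  have hs0 : 0 ≤ s := Real.sqrt_nonneg _
  have hs : 7 / 5 ≤ s := by nlinarith
  induction r, hr using Nat.le_induction with
  | base =>
    have h0 := h 1 le_rfl hrR
    have h1 := mul_liveCount_add_le (by omega) a σ 0
    have h2 : collCount a σ 0 = 0 := by simp [collCount]
    rw [h2] at h1
    have h3 : ((m : ℝ) + 1) ≤ liveCount a σ (levelEnd m 1) + collCount a σ (levelEnd m 1) := by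
      have : m + 1 ≤ liveCount a σ (levelEnd m 1) + collCount a σ (levelEnd m 1) := by
        simp only [levelEnd]; omega
      exact_mod_cast this
    rw [pow_one] at h0
    rw [pow_one, pow_one]
    nlinarith
  | succ r hr ih =>
    have ih := ih (by omega)
    have h0 := h r hr (by omega)
    have h1 := h (r + 1) (by omega) hrR
    have h2 := mul_liveCount_add_le (m := m) (by omega) a σ (levelEnd m r)
    have h3 : (m : ℝ) * liveCount a σ (levelEnd m r) + (m + 1) ≤
        liveCount a σ (levelEnd m (r + 1)) + m * collCount a σ (levelEnd m r) +
          collCount a σ (levelEnd m (r + 1)) := by exact_mod_cast h2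
    have h4 := mul_le_mul_of_nonneg_left ih (by linarith : (0 : ℝ) ≤ m)
    have h5 := mul_le_mul_of_nonneg_left h0 (by linarith : (0 : ℝ) ≤ m)
    have hsr : 0 ≤ s ^ r := by positivity
    rw [pow_succ] at h1 ⊢
    rw [pow_succ]
    -- The surplus `m + 1` absorbs the constant parts of both collision allowances. What remains is
    -- `(1/4 - 1/24) * s ^ 2 ≥ (1/4 + 1/24) * s`, that is `s ≥ 7/5`, which holds because `m ≥ 2`.
    have h6 : 0 ≤ s ^ r * (5 * (s * s) - 7 * s) := mul_nonneg hsr (by nlinarith)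
    rw [hs2] at h6
    nlinarith

/-- The half-edges at the vertices met by the exploration whose partner is unknown. -/
def boundary [Fintype V] (a : V) (σ : Pairing (V × Fin (m + 1))) (T : ℕ) :
    Finset (V × Fin (m + 1)) :=
  (seen a σ T ×ˢ Finset.univ) \ revealed (explore a) σ T

theorem revealed_succ_subset {P : Type*} [DecidableEq P] (z : Pairing P → ℕ → P) (σ : Pairing P)
    (t : ℕ) : revealed z σ (t + 1) ⊆ insert (z σ t) (insert (σ (z σ t)) (revealed z σ t)) := by
  intro p hp
  obtain ⟨s, hs, h⟩ := mem_revealed.1 hp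
  rcases Nat.lt_succ_iff_lt_or_eq.1 hs with h1 | rfl
  · exact Finset.mem_insert_of_mem (Finset.mem_insert_of_mem (mem_revealed.2 ⟨s, h1, h⟩))
  · rcases h with rfl | rfl <;> simp

theorem card_revealed_le (a : V) (σ : Pairing (V × Fin (m + 1))) (T : ℕ) :
    (revealed (explore a) σ T).card ≤ 2 * liveCount a σ T := by
  classical
  induction T with
  | zero => simp [revealed]
  | succ T ih =>
    have h1 := revealed_succ_subset (explore a) σ T
    rw [liveCount, Finset.range_add_one, Finset.filter_insert]
    split_ifs with hl
    · rw [Finset.card_insert_of_notMem (by simp)]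
      have h2 := Finset.card_le_card h1
      have h3 := Finset.card_insert_le (explore a σ T)
        (insert (σ (explore a σ T)) (revealed (explore a) σ T))
      have h4 := Finset.card_insert_le (σ (explore a σ T)) (revealed (explore a) σ T)
      simp only [liveCount] at ih
      omega
    · have h2 := not_not.1 hl
      rw [Finset.insert_eq_of_mem (apply_mem_revealed h2), Finset.insert_eq_of_mem h2] at h1
      exact (Finset.card_le_card h1).trans ih

/-- Every live step either collides or finds a new vertex; the strict inequality accounts for the
root. -/
theorem liveCount_lt_card_seen_add (a : V) (σ : Pairing (V × Fin (m + 1))) (T : ℕ) :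
    liveCount a σ T < (seen a σ T).card + collCount a σ T := by
  classical
  induction T with
  | zero => simp [liveCount, seen]
  | succ T ih =>
    have hsub : seen a σ T ⊆ seen a σ (T + 1) := fun v hv => by
      rw [mem_seen] at hv ⊢
      exact hv.imp_right fun ⟨s, hs, h⟩ => ⟨s, by omega, h⟩
    have h0 := Finset.card_le_card hsub
    simp only [liveCount, collCount] at ih ⊢
    rw [Finset.range_add_one, Finset.filter_insert, Finset.filter_insert]
    by_cases hl : Live (explore a) σ T
    · rw [if_pos hl, Finset.card_insert_of_notMem (by simp)]
      by_cases hc : Collision a σ T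
      · rw [if_pos hc, Finset.card_insert_of_notMem (by simp)]
        omega
      · rw [if_neg hc]
        have hn : (σ (explore a σ T)).1 ∉ seen a σ T := fun h => hc ⟨hl, h⟩
        have h1 : (insert (σ (explore a σ T)).1 (seen a σ T)).card ≤ (seen a σ (T + 1)).card :=
          Finset.card_le_card (Finset.insert_subset
            (mem_seen.2 (Or.inr ⟨T, T.lt_succ_self, rfl⟩)) hsub)
        rw [Finset.card_insert_of_notMem hn] at h1
        omega
    · rw [if_neg hl, if_neg fun h => hl h.1]
      omega

/-- The seen vertices carry `m + 1` half-edges each, and at most two half-edges per live step are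
revealed. Since `m + 1 ≥ 3`, at least one per live step is left over, apart from collisions. -/
theorem liveCount_le_card_boundary_add [Fintype V] (hm : 2 ≤ m) (a : V)
    (σ : Pairing (V × Fin (m + 1))) (T : ℕ) :
    liveCount a σ T ≤ (boundary a σ T).card + (m + 1) * collCount a σ T := by
  have h1 := Finset.le_card_sdiff (revealed (explore a) σ T)
    (seen a σ T ×ˢ (Finset.univ : Finset (Fin (m + 1))))
  rw [Finset.card_product, Finset.card_univ, Fintype.card_fin] at h1
  have h2 := card_revealed_le a σ T
  have h3 := Nat.mul_le_mul_right (m + 1) (liveCount_lt_card_seen_add a σ T).le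
  have h4 : liveCount a σ T * 3 ≤ liveCount a σ T * (m + 1) := Nat.mul_le_mul_left _ (by omega)
  rw [add_mul, mul_comm (collCount a σ T)] at h3
  simp only [boundary]
  omega

theorem exists_walk_apply {ι : Type*} (σ : Pairing (V × ι)) {a : V} {p : V × ι} {r : ℕ}
    (h : ∃ w : σ.graph.Walk a p.1, w.length ≤ r) :
    ∃ w : σ.graph.Walk a (σ p).1, w.length ≤ r + 1 := by
  obtain ⟨w, hw⟩ := h
  by_cases he : p.1 = (σ p).1
  · rw [← he]
    exact ⟨w, by omega⟩
  · have hadj : σ.graph.Adj p.1 (σ p).1 := ⟨he, p.2, rfl⟩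
    exact ⟨w.concat hadj, by rw [SimpleGraph.Walk.length_concat]; omega⟩

theorem exists_walk_explore (hm : 0 < m) (a : V) (σ : Pairing (V × Fin (m + 1))) (r : ℕ) :
    ∀ t < levelEnd m (r + 1), ∃ w : σ.graph.Walk a (explore a σ t).1, w.length ≤ r := by
  induction r with
  | zero =>
    intro t ht
    rw [explore_of_lt _ _ (by simpa [levelEnd] using ht)]
    exact ⟨SimpleGraph.Walk.nil, by simp⟩
  | succ r ih =>
    intro t ht
    rcases lt_or_eq_child hm t with h | ⟨u, j, hj, rfl⟩
    · rw [explore_of_lt _ _ h]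
      exact ⟨SimpleGraph.Walk.nil, by simp⟩
    · rw [explore_child _ _ _ hj]
      refine exists_walk_apply σ (ih u ?_)
      rw [levelEnd] at ht
      refine Nat.lt_of_mul_lt_mul_left (a := m) ?_
      omega

theorem exists_walk_of_mem_seen (hm : 0 < m) {a v : V} {σ : Pairing (V × Fin (m + 1))} {r : ℕ}
    (h : v ∈ seen a σ (levelEnd m r)) : ∃ w : σ.graph.Walk a v, w.length ≤ r := by
  rcases mem_seen.1 h with rfl | ⟨s, hs, rfl⟩
  · exact ⟨SimpleGraph.Walk.nil, by simp⟩
  · cases r with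
    | zero => simp [levelEnd] at hs
    | succ r => exact exists_walk_apply σ (exists_walk_explore hm a σ r s hs)

theorem exists_walk_of_mem_revealed (hm : 0 < m) {a : V} {σ : Pairing (V × Fin (m + 1))} {r : ℕ}
    {p : V × Fin (m + 1)} (h : p ∈ revealed (explore a) σ (levelEnd m r)) :
    ∃ w : σ.graph.Walk a p.1, w.length ≤ r := by
  obtain ⟨s, hs, hp⟩ := mem_revealed.1 h
  cases r with
  | zero => simp [levelEnd] at hs
  | succ r =>
    have h1 := exists_walk_explore hm a σ r s hs
    rcases hp with rfl | rfl
    · exact h1.imp fun w hw => by omega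
    · exact exists_walk_apply σ h1

end Explore

/-! ### Joint exploration from two vertices, and the bound on collisions. -/

section Explore

variable {V : Type*} {m : ℕ}

/-- The exploration from `a` for `T` steps, followed by the exploration from `b`. -/
def exploreBoth (a b : V) (T : ℕ) (σ : Pairing (V × Fin (m + 1))) (t : ℕ) : V × Fin (m + 1) :=
  if t < T then explore a σ t else explore b σ (t - T)

theorem exploreBoth_add (a b : V) (T : ℕ) (σ : Pairing (V × Fin (m + 1))) (s : ℕ) :
    exploreBoth a b T σ (T + s) = explore b σ s := by
  simp [exploreBoth]

theorem agree_left_of_agree_both {a b : V} {T t : ℕ} {σ τ : Pairing (V × Fin (m + 1))}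
    (h : Agree (exploreBoth a b T) t σ τ) (ht : t ≤ T) : Agree (explore a) t σ τ := fun s hs => by
  simpa [exploreBoth, hs.trans_le ht] using h s hs

theorem agree_right_of_agree_both {a b : V} {T s : ℕ} {σ τ : Pairing (V × Fin (m + 1))}
    (h : Agree (exploreBoth a b T) (T + s) σ τ) : Agree (explore b) s σ τ := fun i hi => by
  simpa only [exploreBoth_add] using h (T + i) (by omega)

theorem adapted_exploreBoth (hm : 0 < m) (a b : V) (T : ℕ) :
    Adapted (fun (σ : Pairing (V × Fin (m + 1))) t => exploreBoth a b T σ t) := by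
  intro t σ τ h
  rcases lt_or_ge t T with ht | ht
  · simp only [exploreBoth, ht, if_true]
    exact adapted_explore hm a t σ τ (agree_left_of_agree_both h ht.le)
  · obtain ⟨s, rfl⟩ := Nat.exists_eq_add_of_le ht
    simp only [exploreBoth_add]
    exact adapted_explore hm b s σ τ (agree_right_of_agree_both h)

/-- There is no walk of length at most `D` from `a` to `b`. -/
def SimpleGraph.Far (G : SimpleGraph V) (a b : V) (D : ℕ) : Prop :=
  ¬ ∃ w : G.Walk a b, w.length ≤ D

theorem SimpleGraph.Far.elim {G : SimpleGraph V} {a b v : V} {R : ℕ} (h : G.Far a b (2 * R))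
    (ha : ∃ w : G.Walk a v, w.length ≤ R) (hb : ∃ w : G.Walk b v, w.length ≤ R) : False := by
  obtain ⟨w, hw⟩ := ha
  obtain ⟨w', hw'⟩ := hb
  refine h ⟨w.append w'.reverse, ?_⟩
  rw [SimpleGraph.Walk.length_append, SimpleGraph.Walk.length_reverse]
  omega

variable [DecidableEq V]

theorem revealed_exploreBoth_subset (a b : V) (T s : ℕ) (σ : Pairing (V × Fin (m + 1))) :
    revealed (exploreBoth a b T) σ (T + s) ⊆
      revealed (explore a) σ T ∪ revealed (explore b) σ s := by
  intro p hp
  obtain ⟨i, hi, h⟩ := mem_revealed.1 hp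
  rw [Finset.mem_union]
  rcases lt_or_ge i T with hT | hT
  · left
    simp only [exploreBoth, hT, if_true] at h
    exact mem_revealed.2 ⟨i, hT, h⟩
  · right
    obtain ⟨j, rfl⟩ := Nat.exists_eq_add_of_le hT
    simp only [exploreBoth_add] at h
    exact mem_revealed.2 ⟨j, by omega, h⟩

theorem boundary_eq_of_agree [Fintype V] (hm : 0 < m) {a : V} {σ τ : Pairing (V × Fin (m + 1))}
    {T : ℕ} (h : Agree (explore a) T σ τ) : boundary a σ T = boundary a τ T := by
  rw [boundary, boundary, seen_eq_of_agree h, (adapted_explore hm a).revealed_eq h]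

open Classical in
/-- If the boundary of the exploration from `a` is large and the exploration from `b` has many live
steps, then `a` and `b` are unlikely to be far apart. -/
theorem card_far_le [Fintype V] (hm : 0 < m) (a b : V) (R : ℕ) {ρ k : ℝ} (hρ0 : 0 ≤ ρ)
    (hρ : ρ < 1) :
    ((Finset.univ.filter (fun σ : Pairing (V × Fin (m + 1)) =>
      k ≤ liveCount b σ (levelEnd m R) ∧
      ρ * Fintype.card (V × Fin (m + 1)) ≤ (boundary a σ (levelEnd m R)).card ∧
      σ.graph.Far a b (2 * R))).card : ℝ) ≤
      Real.exp (-(ρ * k)) * Fintype.card (Pairing (V × Fin (m + 1))) := by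
  set T := levelEnd m R with hT
  set z : Pairing (V × Fin (m + 1)) → ℕ → V × Fin (m + 1) := exploreBoth a b T with hzdef
  have hz : Adapted z := adapted_exploreBoth hm a b T
  -- Before time `T` the answers do not yet determine the boundary of the first exploration; the
  -- empty set keeps the target adapted.
  set F : ℕ → Pairing (V × Fin (m + 1)) → Finset (V × Fin (m + 1)) := fun t σ =>
    if T ≤ t then boundary a σ T else ∅ with hFdef
  have hagree : ∀ t σ τ, Agree z t σ τ → T ≤ t → boundary a σ T = boundary a τ T :=
    fun t σ τ h ht => boundary_eq_of_agree hm (agree_left_of_agree_both (h.mono ht) le_rfl)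
  have hF : ∀ t σ τ, Agree z t σ τ → F t σ = F t τ := fun t σ τ h => by
    simp only [hFdef]
    split_ifs with ht
    · exact hagree t σ τ h ht
    · rfl
  -- Good steps are defined by exactly what the avoidance bound requires. That they are numerous has
  -- to be shown only for pairings where `a` and `b` are far apart.
  obtain ⟨good, hgood⟩ : ∃ good : ℕ → Pairing (V × Fin (m + 1)) → Prop, ∀ t σ, good t σ ↔
      T ≤ t ∧ Live z σ t ∧ F t σ ⊆ free z σ t ∧
        ρ * Fintype.card (V × Fin (m + 1)) ≤ (F t σ).card := ⟨_, fun _ _ => Iff.rfl⟩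
  have key := hz.card_avoid_le F good hF (fun t σ τ h => by
    simp only [hgood, hF t σ τ h, hz.live_iff h, hz.free_eq h]) (T := 2 * T) (k := k) hρ hρ0
    (fun t _ σ hg => ((hgood t σ).1 hg).2)
  refine le_trans (Nat.cast_le.2 (Finset.card_le_card fun σ hσ => ?_)) key
  obtain ⟨hk, hbd, hfar⟩ := (Finset.mem_filter.1 hσ).2
  refine Finset.mem_filter.2 ⟨Finset.mem_univ _, ?_, ?_⟩
  -- When the two balls of radius `R` are disjoint, neither exploration reveals anything of the
  -- other. So every live step from `b` is live in the joint exploration and finds the whole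
  -- boundary of `a` free.
  · refine hk.trans (Nat.cast_le.2 ?_)
    refine Finset.card_le_card_of_injOn (fun s => T + s) (fun s hs => ?_)
      (fun s _ s' _ h => by simpa using h)
    obtain ⟨hsT, hlive⟩ := Finset.mem_filter.1 (Finset.mem_coe.1 hs)
    have hsT := Finset.mem_range.1 hsT
    have hmono : ∀ p, p ∈ revealed (explore b) σ s → p ∈ revealed (explore b) σ T := fun p hp => by
      obtain ⟨i, hi, h⟩ := mem_revealed.1 hp
      exact mem_revealed.2 ⟨i, hi.trans hsT, h⟩
    have hxs : explore b σ s ∈ revealed (explore b) σ T :=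
      mem_revealed.2 ⟨s, hsT, Or.inl rfl⟩
    have hzs : z σ (T + s) = explore b σ s := exploreBoth_add a b T σ s
    have hFs : F (T + s) σ = boundary a σ T := by simp [hFdef]
    have hwa : ∀ p ∈ boundary a σ T, ∃ w : σ.graph.Walk a p.1, w.length ≤ R := fun p hp =>
      exists_walk_of_mem_seen hm (Finset.mem_product.1 (Finset.mem_sdiff.1 hp).1).1
    have hwb : ∀ p ∈ revealed (explore b) σ T, ∃ w : σ.graph.Walk b p.1, w.length ≤ R :=
      fun p hp => exists_walk_of_mem_revealed hm hp
    refine Finset.mem_coe.2 (Finset.mem_filter.2 ⟨Finset.mem_range.2 (by simp only; omega),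
      (hgood _ _).2 ⟨by simp, ?_, ?_, ?_⟩⟩)
    · intro hrev
      rw [hzs] at hrev
      rcases Finset.mem_union.1 (revealed_exploreBoth_subset a b T s σ hrev) with h | h
      · exact hfar.elim (exists_walk_of_mem_revealed hm h) (hwb _ hxs)
      · exact hlive h
    · intro p hp
      rw [hFs] at hp
      refine mem_free.2 ⟨?_, fun hrev => ?_⟩
      · rintro rfl
        rw [hzs] at hp
        exact hfar.elim (hwa _ hp) (hwb _ hxs)
      · rcases Finset.mem_union.1 (revealed_exploreBoth_subset a b T s σ hrev) with h | h
        · exact (Finset.mem_sdiff.1 hp).2 h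
        · exact hfar.elim (hwa _ hp) (hwb _ (hmono p h))
    · rw [hFs]
      exact hbd
  -- A hit would produce a vertex within distance `R` of both `a` and `b`.
  · intro t ht hg hmem
    obtain ⟨s, rfl⟩ := Nat.exists_eq_add_of_le ((hgood t σ).1 hg).1
    have hzs : z σ (T + s) = explore b σ s := exploreBoth_add a b T σ s
    rw [hzs] at hmem
    simp only [hFdef, Nat.le_add_right, if_true] at hmem
    refine hfar.elim (v := (σ (explore b σ s)).1)
      (exists_walk_of_mem_seen hm (Finset.mem_product.1 (Finset.mem_sdiff.1 hmem).1).1)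
      (exists_walk_of_mem_revealed hm (r := R) ?_)
    exact mem_revealed.2 ⟨s, by omega, Or.inr rfl⟩

open Classical in
-- Chernoff bound with the half-edges at seen vertices as bad set, at most `T * (m + 1)` of them,
-- while at least half of all half-edges remain free.
theorem card_le_collCount [Fintype V] (hm : 0 < m) (a : V) {T k : ℕ} (hT : 0 < T) (hk : 0 < k)
    (h4 : 4 * T ≤ Fintype.card V * (m + 1)) :
    ((Finset.univ.filter (fun σ : Pairing (V × Fin (m + 1)) => k ≤ collCount a σ T)).card : ℝ) ≤
      (Real.exp 1 * 2 * T ^ 2 / (k * Fintype.card V)) ^ k *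
        Fintype.card (Pairing (V × Fin (m + 1))) := by
  have h4' : (4 * T : ℝ) ≤ Fintype.card V * (m + 1) := by exact_mod_cast h4
  have hT' : (0 : ℝ) < T := by exact_mod_cast hT
  have hn : (0 : ℝ) < Fintype.card V := by
    rcases (Nat.cast_nonneg (α := ℝ) (Fintype.card V)).lt_or_eq with h | h
    · exact h
    · rw [← h] at h4'; linarith
  have key := (adapted_explore hm a).card_badSteps_le (T := T) (b := T * (m + 1)) (k := k)
    (u := Fintype.card V * (m + 1) / 2)
    (fun t σ => seen a σ t ×ˢ Finset.univ) (fun t σ τ h => by rw [seen_eq_of_agree h])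
    (by positivity) (by positivity) hT hk (fun t ht σ => by
      rw [Finset.card_product, Finset.card_univ, Fintype.card_fin]
      exact Nat.mul_le_mul_right _ ((card_seen_le a σ t).trans ht)) (by
      rw [Fintype.card_prod, Fintype.card_fin]
      push_cast
      linarith)
  have he : Real.exp 1 * 2 * T ^ 2 / (k * Fintype.card V) =
      Real.exp 1 * ((T * (m + 1) : ℕ) : ℝ) * T / (k * (Fintype.card V * (m + 1) / 2)) := by
    push_cast
    have : (k : ℝ) ≠ 0 := by exact_mod_cast hk.ne'
    field_simp
  rw [he]
  refine le_trans (Nat.cast_le.2 (Finset.card_le_card fun σ hσ => ?_)) key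
  refine Finset.mem_filter.2 ⟨Finset.mem_univ _, (Finset.mem_filter.1 hσ).2.trans ?_⟩
  refine Finset.card_le_card fun t ht => ?_
  obtain ⟨h1, h2, h3⟩ := Finset.mem_filter.1 ht
  exact Finset.mem_filter.2 ⟨h1, h2, Finset.mem_product.2 ⟨h3, Finset.mem_univ _⟩⟩

end Explore

/-! ### Quantitative bounds for pairings and the choice of the radius. -/

section Asymptotics

open Classical in
-- With `X = √m ^ r`, `T ≤ 3 * X ^ 2` and `k > X / 24`, the Chernoff base is at most `1200 * X ^ 3 /
-- n`. For small `X` the exponent `k ≥ 2` gives `O(n⁻²)` at once. For large `X` the base is only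
-- known to be at most `n ^ (-1/8)`, but then `k ≥ 16`.
theorem card_collCount_gt_le {m n R : ℕ} (hm : 2 ≤ m) (a : Fin n)
    (h1 : (1200 * (√m ^ R) ^ 3) ^ 8 ≤ (n : ℝ) ^ 7) (h2 : 1200 * 432 ^ 3 ≤ (n : ℝ))
    (h3 : 12 * (m : ℝ) ^ R ≤ n * (m + 1)) {r : ℕ} (hr : 1 ≤ r) (hrR : r ≤ R) :
    ((Finset.univ.filter (fun σ : Pairing (Fin n × Fin (m + 1)) =>
      ¬ (collCount a σ (levelEnd m r) : ℝ) ≤ 1 + √m ^ r / 24)).card : ℝ) ≤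
      (1200 * 432 ^ 3) ^ 2 / (n : ℝ) ^ 2 * Fintype.card (Pairing (Fin n × Fin (m + 1))) := by
  have hm' : (2 : ℝ) ≤ m := by exact_mod_cast hm
  have hn : (0 : ℝ) < n := by linarith
  set s := √(m : ℝ)
  have hs2 : s * s = m := Real.mul_self_sqrt (Nat.cast_nonneg _)
  have hs0 : 0 ≤ s := Real.sqrt_nonneg _
  have hs1 : 1 ≤ s := by nlinarith
  set X := s ^ r with hX
  have hX0 : 0 < X := by positivity
  have hX2 : X * X = (m : ℝ) ^ r := by rw [hX, ← mul_pow, hs2]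
  set T := levelEnd m r with hT
  have hTle : (T : ℝ) ≤ 3 * (m : ℝ) ^ r := by
    have : T ≤ 3 * m ^ r := by have := levelEnd_add_le hm r; omega
    exact_mod_cast this
  have hT0 : 0 < T := by
    obtain ⟨r', rfl⟩ := Nat.exists_eq_add_of_le hr
    rw [hT, add_comm, levelEnd]; omega
  have hmr : (m : ℝ) ^ r ≤ (m : ℝ) ^ R := pow_le_pow_right₀ (by linarith) hrR
  set k := ⌊1 + X / 24⌋₊ + 1 with hk
  have hk1 : 1 + X / 24 < k := by rw [hk]; push_cast; exact Nat.lt_floor_add_one _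
  have hk2 : 2 ≤ k := by
    have : (1 : ℝ) < k := by linarith
    exact_mod_cast this
  have hk0 : (0 : ℝ) < k := by linarith
  have key := card_le_collCount (V := Fin n) (m := m) (by omega) a hT0 (k := k) (by omega) (by
    rw [Fintype.card_fin]
    have : (4 * T : ℝ) ≤ n * (m + 1) := by linarith
    exact_mod_cast this)
  rw [Fintype.card_fin] at key
  refine le_trans (Nat.cast_le.2 (Finset.card_le_card fun σ hσ => ?_)) (key.trans ?_)
  · refine Finset.mem_filter.2 ⟨Finset.mem_univ _, ?_⟩
    have := not_le.1 (Finset.mem_filter.1 hσ).2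
    exact (Nat.floor_lt (by positivity)).2 this
  refine mul_le_mul_of_nonneg_right ?_ (Nat.cast_nonneg _)
  set β := Real.exp 1 * 2 * T ^ 2 / (k * n) with hβ
  have hβ0 : 0 ≤ β := by positivity
  have hβ1 : β ≤ 1200 * X ^ 3 / n := by
    rw [hβ, div_le_div_iff₀ (by positivity) hn]
    have e1 : Real.exp 1 ≤ 25 / 9 := by linarith [Real.exp_one_lt_d9]
    have e2 : (T : ℝ) ^ 2 ≤ 9 * (X ^ 3 * X) := by
      calc (T : ℝ) ^ 2 ≤ (3 * (X * X)) ^ 2 := pow_le_pow_left₀ (Nat.cast_nonneg _) (hX2 ▸ hTle) _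
        _ = _ := by ring
    have e3 : X ≤ 24 * k := by linarith
    calc Real.exp 1 * 2 * T ^ 2 * n ≤ 25 / 9 * 2 * (9 * (X ^ 3 * (24 * k))) * n := by
          gcongr
          nlinarith [pow_pos hX0 3]
      _ = 1200 * X ^ 3 * (k * n) := by ring
  rcases le_or_gt X 432 with hX432 | hX432
  · have hβ2 : β ≤ 1200 * 432 ^ 3 / n := hβ1.trans (by gcongr)
    have hβ3 : β ≤ 1 := hβ2.trans ((div_le_one hn).2 h2)
    calc β ^ k ≤ β ^ 2 := pow_le_pow_of_le_one hβ0 hβ3 hk2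
      _ ≤ (1200 * 432 ^ 3 / n) ^ 2 := pow_le_pow_left₀ hβ0 hβ2 _
      _ = _ := by rw [div_pow]
  · have hβ2 : β ≤ 1200 * (s ^ R) ^ 3 / n := hβ1.trans (by
      have : X ≤ s ^ R := pow_le_pow_right₀ hs1 hrR
      gcongr)
    have hβ8 : β ^ 8 ≤ 1 / n := by
      calc β ^ 8 ≤ (1200 * (s ^ R) ^ 3 / n) ^ 8 := pow_le_pow_left₀ hβ0 hβ2 _
        _ ≤ (n : ℝ) ^ 7 / n ^ 8 := by rw [div_pow]; gcongr
        _ = 1 / n := by field_simp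
    have hβ3 : β ≤ 1 := by
      by_contra hlt
      have h1 : 1 < β ^ 8 := one_lt_pow₀ (not_le.1 hlt) (by norm_num)
      have : 1 / (n : ℝ) ≤ 1 := (div_le_one hn).2 (by linarith)
      linarith
    have hk16 : 16 ≤ k := by
      have : (16 : ℝ) < k := by linarith
      exact_mod_cast this.le
    calc β ^ k ≤ β ^ 16 := pow_le_pow_of_le_one hβ0 hβ3 hk16
      _ = (β ^ 8) ^ 2 := by ring
      _ ≤ (1 / n) ^ 2 := pow_le_pow_left₀ (by positivity) hβ8 _
      _ ≤ _ := by rw [div_pow]; gcongr; norm_num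

open Classical in
-- A union bound: either some exploration collides too often at some depth, or some pair is far
-- apart although both explorations are large. The second case uses `card_far_le` with `m ^ R / 2`
-- live steps and a boundary of at least `m ^ R / 4`.
theorem card_exists_far_le {m n R : ℕ} (hm : 2 ≤ m)
    (h1 : (1200 * (√m ^ R) ^ 3) ^ 8 ≤ (n : ℝ) ^ 7) (h2 : 1200 * 432 ^ 3 ≤ (n : ℝ))
    (h3 : 12 * (m : ℝ) ^ R ≤ n * (m + 1)) (h4 : 5 * ((m : ℝ) + 1) ≤ √m ^ R) (hR : 1 ≤ R) :
    ((Finset.univ.filter (fun σ : Pairing (Fin n × Fin (m + 1)) =>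
      ∃ a b, σ.graph.Far a b (2 * R))).card : ℝ) ≤
      (n * (R * ((1200 * 432 ^ 3) ^ 2 / (n : ℝ) ^ 2)) +
        n ^ 2 * Real.exp (-((m : ℝ) ^ R * m ^ R / (8 * (n * (m + 1)))))) *
          Fintype.card (Pairing (Fin n × Fin (m + 1))) := by
  have hm' : (2 : ℝ) ≤ m := by exact_mod_cast hm
  have hn : (0 : ℝ) < n := by linarith
  set Ω := Fintype.card (Pairing (Fin n × Fin (m + 1)))
  set N : ℝ := n * (m + 1) with hN
  have hN0 : 0 < N := by positivity
  have hNcard : (Fintype.card (Fin n × Fin (m + 1)) : ℝ) = N := by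
    rw [Fintype.card_prod, Fintype.card_fin, Fintype.card_fin]; push_cast; rfl
  set X := √(m : ℝ) ^ R with hX
  have hX2 : X * X = (m : ℝ) ^ R := by
    rw [hX, ← mul_pow, Real.mul_self_sqrt (Nat.cast_nonneg _)]
  set ρ : ℝ := (m : ℝ) ^ R / 4 / N with hρ
  have hρ0 : 0 ≤ ρ := by positivity
  have hρ1 : ρ < 1 := by
    rw [hρ, div_lt_one hN0]
    have : 0 < (m : ℝ) ^ R := by positivity
    linarith
  set A : Fin n → ℕ → Finset (Pairing (Fin n × Fin (m + 1))) := fun a r =>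
    Finset.univ.filter fun σ => ¬ (collCount a σ (levelEnd m r) : ℝ) ≤ 1 + √m ^ r / 24
  set B : Fin n → Fin n → Finset (Pairing (Fin n × Fin (m + 1))) := fun a b =>
    Finset.univ.filter fun σ => (m : ℝ) ^ R / 2 ≤ liveCount b σ (levelEnd m R) ∧
      ρ * Fintype.card (Fin n × Fin (m + 1)) ≤ (boundary a σ (levelEnd m R)).card ∧
      σ.graph.Far a b (2 * R)
  have hA : ∀ a, ∀ r ∈ Finset.Icc 1 R, ((A a r).card : ℝ) ≤
      (1200 * 432 ^ 3) ^ 2 / (n : ℝ) ^ 2 * Ω :=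
    fun a r hr => card_collCount_gt_le hm a h1 h2 h3 (Finset.mem_Icc.1 hr).1 (Finset.mem_Icc.1 hr).2
  have hB : ∀ a b, ((B a b).card : ℝ) ≤
      Real.exp (-((m : ℝ) ^ R * m ^ R / (8 * N))) * Ω := fun a b => by
    have he : (m : ℝ) ^ R * m ^ R / (8 * N) = ρ * (m ^ R / 2) := by
      rw [hρ]; field_simp; norm_num
    rw [he]
    exact card_far_le (by omega) a b R hρ0 hρ1
  have hsub : (Finset.univ.filter (fun σ : Pairing (Fin n × Fin (m + 1)) =>
      ∃ a b, σ.graph.Far a b (2 * R))) ⊆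
      (Finset.univ.biUnion fun a => (Finset.Icc 1 R).biUnion fun r => A a r) ∪
        Finset.univ.biUnion fun a => Finset.univ.biUnion fun b => B a b := by
    intro σ hσ
    obtain ⟨a, b, hfar⟩ := (Finset.mem_filter.1 hσ).2
    rw [Finset.mem_union]
    by_cases hcoll : ∃ a, ∃ r, (1 ≤ r ∧ r ≤ R) ∧
        ¬ (collCount a σ (levelEnd m r) : ℝ) ≤ 1 + √m ^ r / 24
    · obtain ⟨a, r, hr, h⟩ := hcoll
      left
      simp only [Finset.mem_biUnion, Finset.mem_univ, true_and, Finset.mem_Icc]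
      exact ⟨a, r, hr, Finset.mem_filter.2 ⟨Finset.mem_univ _, h⟩⟩
    · right
      push Not at hcoll
      have hc : ∀ a r, 1 ≤ r → r ≤ R →
          (collCount a σ (levelEnd m r) : ℝ) ≤ 1 + √m ^ r / 24 := fun a r h h' => hcoll a r ⟨h, h'⟩
      simp only [Finset.mem_biUnion, Finset.mem_univ, true_and]
      refine ⟨a, b, Finset.mem_filter.2 ⟨Finset.mem_univ _, ?_, ?_, hfar⟩⟩
      · have := le_liveCount hm b σ R (hc b) hR le_rfl
        have : 0 ≤ √(m : ℝ) ^ R := by positivity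
        linarith
      · have g1 := le_liveCount hm a σ R (hc a) hR le_rfl
        have g2 := liveCount_le_card_boundary_add hm a σ (levelEnd m R)
        have g3 : (liveCount a σ (levelEnd m R) : ℝ) ≤ (boundary a σ (levelEnd m R)).card +
          (m + 1) * collCount a σ (levelEnd m R) := by exact_mod_cast g2
        have g4 := hc a R hR le_rfl
        rw [hNcard, hρ, div_mul_cancel₀ _ hN0.ne']
        have g5 : ((m : ℝ) + 1) * collCount a σ (levelEnd m R) ≤ (m + 1) * (1 + X / 24) :=
          mul_le_mul_of_nonneg_left g4 (by positivity)
        have g6 : 0 ≤ X := by positivity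
        nlinarith
  refine (Nat.cast_le.2 ((Finset.card_le_card hsub).trans (Finset.card_union_le _ _))).trans ?_
  rw [Nat.cast_add, add_mul]
  refine add_le_add ?_ ?_
  · refine (Nat.cast_le.2 Finset.card_biUnion_le).trans ?_
    rw [Nat.cast_sum]
    have : ∀ a ∈ Finset.univ, ((((Finset.Icc 1 R).biUnion fun r => A a r).card : ℕ) : ℝ) ≤
        R * ((1200 * 432 ^ 3) ^ 2 / (n : ℝ) ^ 2 * Ω) := fun a _ => by
      refine (Nat.cast_le.2 Finset.card_biUnion_le).trans ?_
      rw [Nat.cast_sum]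
      refine (Finset.sum_le_sum (hA a)).trans ?_
      rw [Finset.sum_const, Nat.card_Icc, nsmul_eq_mul, Nat.add_sub_cancel]
    refine (Finset.sum_le_sum this).trans ?_
    rw [Finset.sum_const, Finset.card_univ, Fintype.card_fin, nsmul_eq_mul]
    exact le_of_eq (by ring)
  · refine (Nat.cast_le.2 Finset.card_biUnion_le).trans ?_
    rw [Nat.cast_sum]
    have : ∀ a ∈ Finset.univ, (((Finset.univ.biUnion fun b => B a b).card : ℕ) : ℝ) ≤
        n * (Real.exp (-((m : ℝ) ^ R * m ^ R / (8 * N))) * Ω) := fun a _ => by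
      refine (Nat.cast_le.2 Finset.card_biUnion_le).trans ?_
      rw [Nat.cast_sum]
      refine (Finset.sum_le_sum fun b _ => hB a b).trans ?_
      rw [Finset.sum_const, Finset.card_univ, Fintype.card_fin, nsmul_eq_mul]
    refine (Finset.sum_le_sum this).trans ?_
    rw [Finset.sum_const, Finset.card_univ, Fintype.card_fin, nsmul_eq_mul]
    exact le_of_eq (by ring)

theorem eventually_mul_log_pow_le (K : ℝ) (j : ℕ) :
    ∀ᶠ n : ℕ in atTop, K * Real.log n ^ j ≤ n := by
  have h := (Real.isLittleO_pow_log_id_atTop (n := j)).comp_tendsto tendsto_natCast_atTop_atTop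
  have h1 := h.bound (c := (|K| + 1)⁻¹) (by positivity)
  filter_upwards [h1, eventually_ge_atTop 1] with n hn hn1
  have hlog : 0 ≤ Real.log n ^ j := pow_nonneg (Real.log_natCast_nonneg n) _
  simp only [Function.comp, id, Real.norm_eq_abs, abs_of_nonneg hlog, Nat.abs_cast] at hn
  rw [inv_mul_eq_div, le_div_iff₀ (by positivity)] at hn
  nlinarith [le_abs_self K]

theorem tendsto_log_natCast : Tendsto (fun n : ℕ => Real.log n) atTop atTop :=
  Real.tendsto_log_atTop.comp tendsto_natCast_atTop_atTop

/-- The radius of the neighbourhoods of `√n * log n` vertices is `O(log n)`. -/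
theorem radius_le {m n R : ℕ} (hm : 2 ≤ m) (hmn : (m : ℝ) ≤ n) (hlog : Real.log n ^ 2 ≤ n)
    (h : (m : ℝ) ^ R ≤ m * (√n * Real.log n)) : (R : ℝ) ≤ 3 * Real.log n := by
  have hm' : (2 : ℝ) ≤ m := by exact_mod_cast hm
  have hn : (2 : ℝ) ≤ n := hm'.trans hmn
  have h1 : Real.log n ≤ √n := Real.le_sqrt_of_sq_le hlog
  have h2 : √(n : ℝ) * √n = n := Real.mul_self_sqrt (by positivity)
  have h3 : (2 : ℝ) ^ R ≤ n * n := by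
    calc (2 : ℝ) ^ R ≤ (m : ℝ) ^ R := pow_le_pow_left₀ (by norm_num) hm' _
      _ ≤ m * (√n * √n) := h.trans (by gcongr)
      _ ≤ n * n := by rw [h2]; gcongr
  have h4 := Real.log_le_log (by positivity) h3
  rw [Real.log_pow, Real.log_mul (by positivity) (by positivity)] at h4
  have h5 := Real.log_two_gt_d9
  have h6 : 0 ≤ (R : ℝ) := Nat.cast_nonneg _
  nlinarith

open Classical in
/-- With high probability all distances of the graph of a random pairing are at most `2 * R`, where
`m ^ R` is about `√n * log n`. -/
theorem eventually_card_exists_far_le {m : ℕ} (hm : 2 ≤ m) {ε : ℝ} (hε : 0 < ε) :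
    ∀ᶠ n : ℕ in atTop, ∀ R : ℕ, √n * Real.log n ≤ (m : ℝ) ^ R →
      (m : ℝ) ^ R ≤ m * (√n * Real.log n) →
      ((Finset.univ.filter (fun σ : Pairing (Fin n × Fin (m + 1)) =>
        ∃ a b, σ.graph.Far a b (2 * R))).card : ℝ) ≤
          ε * Fintype.card (Pairing (Fin n × Fin (m + 1))) := by
  have hm' : (2 : ℝ) ≤ m := by exact_mod_cast hm
  set C : ℝ := (1200 * 432 ^ 3) ^ 2 with hC
  filter_upwards [eventually_mul_log_pow_le (1200 ^ 8 * m ^ 12) 12, eventually_mul_log_pow_le 144 2,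
    tendsto_natCast_atTop_atTop.eventually_ge_atTop (1200 * 432 ^ 3 : ℝ),
    tendsto_log_natCast.eventually_ge_atTop (25 * ((m : ℝ) + 1) ^ 2),
    tendsto_log_natCast.eventually_ge_atTop (24 * ((m : ℝ) + 1)),
    eventually_mul_log_pow_le (6 * C / ε) 1,
    tendsto_natCast_atTop_atTop.eventually_ge_atTop (2 / ε : ℝ),
    tendsto_natCast_atTop_atTop.eventually_ge_atTop (m : ℝ)] with n e1 e2 e3 e4 e5 e6 e7 e8
  intro R hR1 hR2
  have hn : (1 : ℝ) ≤ n := by linarith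
  have hn0 : (0 : ℝ) < n := by linarith
  set q := √(n : ℝ) with hq
  have hq2 : q * q = n := Real.mul_self_sqrt (by positivity)
  have hq0 : 0 ≤ q := Real.sqrt_nonneg _
  have hq1 : 1 ≤ q := by nlinarith
  set l := Real.log n with hl
  have hl0 : 0 < l := by nlinarith
  have hl12 : 12 * l ≤ q := by
    refine Real.le_sqrt_of_sq_le ?_
    rw [mul_pow]; norm_num; exact e2
  have hmR : 0 < (m : ℝ) ^ R := by positivity
  have hX2 : √(m : ℝ) ^ R * √(m : ℝ) ^ R = (m : ℝ) ^ R := by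
    rw [← mul_pow, Real.mul_self_sqrt (Nat.cast_nonneg _)]
  have hX0 : 0 ≤ √(m : ℝ) ^ R := by positivity
  have hbig : 25 * ((m : ℝ) + 1) ^ 2 ≤ (m : ℝ) ^ R := by nlinarith
  -- The upper bound on `m ^ R` makes the left side `n ^ 6` times a power of `log n`, which leaves a
  -- factor `n` to spare.
  have c1 : (1200 * (√m ^ R) ^ 3) ^ 8 ≤ (n : ℝ) ^ 7 := by
    calc (1200 * (√(m : ℝ) ^ R) ^ 3) ^ 8 = 1200 ^ 8 * (√(m : ℝ) ^ R * √(m : ℝ) ^ R) ^ 12 := by ring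
      _ ≤ 1200 ^ 8 * (m * (q * l)) ^ 12 := by rw [hX2]; gcongr
      _ = 1200 ^ 8 * m ^ 12 * l ^ 12 * (q * q) ^ 6 := by ring
      _ ≤ n * (q * q) ^ 6 := by gcongr
      _ = n ^ 7 := by rw [hq2]; ring
  have c3 : 12 * (m : ℝ) ^ R ≤ n * (m + 1) := by
    have : m * (q * (12 * l)) ≤ m * (q * q) := by gcongr
    rw [hq2] at this
    nlinarith
  have c4 : 5 * ((m : ℝ) + 1) ≤ √m ^ R := by
    refine le_of_sq_le_sq ?_ hX0
    rw [mul_pow, sq (√(m : ℝ) ^ R), hX2]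
    linarith
  have c5 : 1 ≤ R := by
    by_contra h
    have : R = 0 := by omega
    rw [this, pow_zero] at hbig
    nlinarith
  refine (card_exists_far_le hm c1 e3 c3 c4 c5).trans ?_
  refine mul_le_mul_of_nonneg_right ?_ (Nat.cast_nonneg _)
  have hRl : (R : ℝ) ≤ 3 * l := radius_le hm e8 (by nlinarith) hR2
  have p1 : n * (R * (C / (n : ℝ) ^ 2)) ≤ ε / 2 := by
    have : n * (R * (C / (n : ℝ) ^ 2)) = R * C / n := by field_simp
    rw [this, div_le_iff₀ hn0]
    rw [pow_one, div_mul_eq_mul_div, div_le_iff₀ hε] at e6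
    have hC0 : 0 < C := by positivity
    nlinarith
  have p2 : n ^ 2 * Real.exp (-((m : ℝ) ^ R * m ^ R / (8 * (n * (m + 1))))) ≤ ε / 2 := by
    -- Here `m ^ R ≥ √n * log n` enters: the exponent is at least `log² n / (8 * (m + 1)) ≥ 3 * log
    -- n`, so the union over `n ^ 2` pairs costs `1 / n`.
    have : 3 * l ≤ (m : ℝ) ^ R * m ^ R / (8 * (n * (m + 1))) := by
      rw [le_div_iff₀ (by positivity)]
      calc 3 * l * (8 * (n * (m + 1))) = l * (24 * (m + 1)) * (q * q) := by rw [hq2]; ring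
        _ ≤ l * l * (q * q) := by gcongr
        _ = (q * l) * (q * l) := by ring
        _ ≤ _ := by gcongr
    have : Real.exp (-((m : ℝ) ^ R * m ^ R / (8 * (n * (m + 1))))) ≤ 1 / (n : ℝ) ^ 3 := by
      calc _ ≤ Real.exp (-(3 * l)) := Real.exp_le_exp.2 (by linarith)
        _ = 1 / (n : ℝ) ^ 3 := by
          rw [Real.exp_neg, show (3 : ℝ) * l = (3 : ℕ) * l by norm_num, Real.exp_nat_mul, hl,
            Real.exp_log hn0, one_div]
    refine (mul_le_mul_of_nonneg_left this (by positivity)).trans ?_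
    calc (n : ℝ) ^ 2 * (1 / (n : ℝ) ^ 3) = 1 / n := by field_simp
      _ ≤ ε / 2 := by
        rw [div_le_div_iff₀ hn0 (by norm_num)]
        rw [div_le_iff₀ hε] at e7
        linarith
  linarith

end Asymptotics

/-! ### Switchings: a random pairing is simple with probability bounded below. -/

section Simple

variable {V : Type*} {m : ℕ}

/-- The pair of vertices joined by the edge through a half-edge. -/
def Pairing.ends {ι : Type*} (σ : Pairing (V × ι)) (p : V × ι) : V × V := (p.1, (σ p).1)

/-- A pairing is simple if its multigraph has neither loops nor multiple edges. -/
def Pairing.IsSimple {ι : Type*} (σ : Pairing (V × ι)) : Prop := Function.Injective σ.ends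

/-- The half-edges that lie on a loop or a multiple edge. -/
noncomputable def badPoints [Fintype V] (σ : Pairing (V × Fin (m + 1))) :
    Finset (V × Fin (m + 1)) := by
  classical exact Finset.univ.filter fun p => ∃ q, q ≠ p ∧ σ.ends q = σ.ends p

theorem mem_badPoints [Fintype V] {σ : Pairing (V × Fin (m + 1))} {p : V × Fin (m + 1)} :
    p ∈ badPoints σ ↔ ∃ q, q ≠ p ∧ σ.ends q = σ.ends p := by
  simp [badPoints]

theorem isSimple_iff [Fintype V] {σ : Pairing (V × Fin (m + 1))} :
    σ.IsSimple ↔ (badPoints σ).card ≤ 0 := by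
  rw [Nat.le_zero, Finset.card_eq_zero, Finset.eq_empty_iff_forall_notMem]
  simp only [mem_badPoints]
  refine ⟨fun h p ⟨q, hq, he⟩ => hq (h he), fun h p q he => ?_⟩
  by_contra hpq
  exact h q ⟨p, hpq, he⟩

variable [DecidableEq V]

/-- The vertices equal or adjacent to an end point of the edge through `p`. -/
def nearEnds (σ : Pairing (V × Fin (m + 1))) (p : V × Fin (m + 1)) : Finset V :=
  {p.1, (σ p).1} ∪ (Finset.univ.image fun i => (σ (p.1, i)).1) ∪
    Finset.univ.image fun i => (σ ((σ p).1, i)).1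

theorem card_nearEnds_le (σ : Pairing (V × Fin (m + 1))) (p : V × Fin (m + 1)) :
    (nearEnds σ p).card ≤ 2 * m + 4 := by
  have h1 : ((Finset.univ : Finset (Fin (m + 1))).image fun i => (σ (p.1, i)).1).card ≤ m + 1 :=
    Finset.card_image_le.trans (by simp)
  have h2 : ((Finset.univ : Finset (Fin (m + 1))).image fun i => (σ ((σ p).1, i)).1).card ≤ m + 1 :=
    Finset.card_image_le.trans (by simp)
  have h3 : ({p.1, (σ p).1} : Finset V).card ≤ 2 := Finset.card_le_two
  have h4 := Finset.card_union_le ({p.1, (σ p).1} : Finset V)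
    (Finset.univ.image fun i => (σ (p.1, i)).1)
  have h5 := Finset.card_union_le (({p.1, (σ p).1} : Finset V) ∪
    (Finset.univ.image fun i => (σ (p.1, i)).1)) (Finset.univ.image fun i => (σ ((σ p).1, i)).1)
  simp only [nearEnds]
  omega

/-- The edge through `q` is a non-loop that is far from the edge through `p`. -/
def Switchable (σ : Pairing (V × Fin (m + 1))) (p q : V × Fin (m + 1)) : Prop :=
  q.1 ∉ nearEnds σ p ∧ (σ q).1 ∉ nearEnds σ p ∧ q.1 ≠ (σ q).1

/-- Replace the edges through `p` and `q` by two edges across. -/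
def switch (σ : Pairing (V × Fin (m + 1))) (p q : V × Fin (m + 1)) : Pairing (V × Fin (m + 1)) :=
  Pairing.conj (Equiv.swap (σ p) q) σ

section Switch

variable {σ : Pairing (V × Fin (m + 1))} {p q : V × Fin (m + 1)}

theorem not_mem_nearEnds {v : V} : v ∉ nearEnds σ p ↔ v ≠ p.1 ∧ v ≠ (σ p).1 ∧
    (∀ r : V × Fin (m + 1), r.1 = p.1 → (σ r).1 ≠ v) ∧
    (∀ r : V × Fin (m + 1), r.1 = (σ p).1 → (σ r).1 ≠ v) := by
  simp only [nearEnds, Finset.mem_union, Finset.mem_insert, Finset.mem_singleton, Finset.mem_image,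
    Finset.mem_univ, true_and, not_or, not_exists, and_assoc]
  refine and_congr_right fun _ => and_congr_right fun _ => and_congr ?_ ?_
  all_goals
    refine ⟨?_, fun h i => h (_, i) rfl⟩
    rintro h ⟨w, i⟩ rfl
    exact h i

theorem Switchable.switch_apply (h : Switchable σ p q) :
    switch σ p q p = q ∧ switch σ p q q = p ∧ switch σ p q (σ p) = σ q ∧
      switch σ p q (σ q) = σ p ∧
      ∀ r, r ≠ p → r ≠ q → r ≠ σ p → r ≠ σ q → switch σ p q r = σ r := by
  obtain ⟨h1, h2, -⟩ := h
  rw [not_mem_nearEnds] at h1 h2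
  have n1 : p ≠ σ p := (σ.apply_ne p).symm
  have n2 : p ≠ q := fun h => h1.1 (by rw [h])
  have n3 : σ q ≠ σ p := fun h => h2.2.1 (by rw [h])
  have n4 : σ q ≠ q := σ.apply_ne q
  have hp : switch σ p q p = q := by
    rw [switch, Pairing.conj_swap_apply, Equiv.swap_apply_of_ne_of_ne n1 n2, Equiv.swap_apply_left]
  have hq : switch σ p q (σ q) = σ p := by
    rw [switch, Pairing.conj_swap_apply, Equiv.swap_apply_of_ne_of_ne n3 n4, σ.apply_apply,
      Equiv.swap_apply_right]
  refine ⟨hp, (Pairing.apply_eq_comm _).1 hp, (Pairing.apply_eq_comm _).1 hq, hq, ?_⟩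
  intro r r1 r2 r3 r4
  rw [switch, Pairing.conj_swap_apply, Equiv.swap_apply_of_ne_of_ne r3 r2,
    Equiv.swap_apply_of_ne_of_ne (fun h => r1 (σ.injective h))
      (fun h => r4 ((σ.apply_eq_comm.1 h).symm))]

/-- The new edges join vertices that were neither equal nor adjacent, so they are neither loops nor
parallel to an old edge. They are not parallel to each other because the edge through `q` is not a
loop, which matters when `p` lies on one. -/
theorem Switchable.ends_switch_ne (h : Switchable σ p q) {r s : V × Fin (m + 1)}
    (hr : r = p ∨ r = q ∨ r = σ p ∨ r = σ q) (hs : s ≠ r) :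
    (switch σ p q).ends s ≠ (switch σ p q).ends r := by
  obtain ⟨e1, e2, e3, e4, e5⟩ := h.switch_apply
  obtain ⟨h1, h2, h3⟩ := h
  rw [not_mem_nearEnds] at h1 h2
  obtain ⟨a1, a2, a3, a4⟩ := h1
  obtain ⟨b1, b2, b3, b4⟩ := h2
  have c1 : ∀ r : V × Fin (m + 1), r.1 = q.1 → (σ r).1 ≠ p.1 := fun r hr h =>
    a3 (σ r) h (by rw [σ.apply_apply, hr])
  have c2 : ∀ r : V × Fin (m + 1), r.1 = q.1 → (σ r).1 ≠ (σ p).1 := fun r hr h =>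
    a4 (σ r) h (by rw [σ.apply_apply, hr])
  have c3 : ∀ r : V × Fin (m + 1), r.1 = (σ q).1 → (σ r).1 ≠ p.1 := fun r hr h =>
    b3 (σ r) h (by rw [σ.apply_apply, hr])
  have c4 : ∀ r : V × Fin (m + 1), r.1 = (σ q).1 → (σ r).1 ≠ (σ p).1 := fun r hr h =>
    b4 (σ r) h (by rw [σ.apply_apply, hr])
  intro he
  have he1 : s.1 = r.1 := (Prod.mk.inj he).1
  have he2 : (switch σ p q s).1 = (switch σ p q r).1 := (Prod.mk.inj he).2
  by_cases s1 : s = p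
  · subst s1; rcases hr with rfl | rfl | rfl | rfl <;> grind
  by_cases s2 : s = q
  · subst s2; rcases hr with rfl | rfl | rfl | rfl <;> grind
  by_cases s3 : s = σ p
  · subst s3; rcases hr with rfl | rfl | rfl | rfl <;> grind
  by_cases s4 : s = σ q
  · subst s4; rcases hr with rfl | rfl | rfl | rfl <;> grind
  rw [e5 s s1 s2 s3 s4] at he2
  rcases hr with rfl | rfl | rfl | rfl <;> grind

variable [Fintype V]

theorem Switchable.card_badPoints_lt (h : Switchable σ p q) (hp : p ∈ badPoints σ) :
    (badPoints (switch σ p q)).card < (badPoints σ).card := by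
  refine Finset.card_lt_card (Finset.ssubset_iff_subset_ne.2 ⟨fun r hr => ?_, fun he => ?_⟩)
  · obtain ⟨s, hs, hsr⟩ := mem_badPoints.1 hr
    obtain ⟨-, -, -, -, e5⟩ := h.switch_apply
    have hr4 : ¬ (r = p ∨ r = q ∨ r = σ p ∨ r = σ q) := fun h4 => h.ends_switch_ne h4 hs hsr
    have hs4 : ¬ (s = p ∨ s = q ∨ s = σ p ∨ s = σ q) := fun h4 =>
      h.ends_switch_ne h4 hs.symm hsr.symm
    push Not at hr4 hs4
    refine mem_badPoints.2 ⟨s, hs, ?_⟩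
    rw [Pairing.ends, Pairing.ends, e5 r hr4.1 hr4.2.1 hr4.2.2.1 hr4.2.2.2,
      e5 s hs4.1 hs4.2.1 hs4.2.2.1 hs4.2.2.2] at hsr
    exact hsr
  · rw [← he] at hp
    obtain ⟨s, hs, hsp⟩ := mem_badPoints.1 hp
    exact h.ends_switch_ne (Or.inl rfl) hs hsp

/-- This limits the ways to undo a switching. Badness of `p` means either a loop or a parallel edge
that survives the switching, so the lost end point equals `p.1` or is still a neighbour of it. -/
theorem Switchable.fst_apply_eq (h : Switchable σ p q) (hp : p ∈ badPoints σ) :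
    (σ p).1 = (switch σ p q q).1 ∨
      ∃ i, (σ p).1 = (switch σ p q ((switch σ p q q).1, i)).1 := by
  obtain ⟨-, e2, -, -, e5⟩ := h.switch_apply
  rw [e2]
  obtain ⟨r, hr, he⟩ := mem_badPoints.1 hp
  have he1 : r.1 = p.1 := (Prod.mk.inj he).1
  have he2 : (σ r).1 = (σ p).1 := (Prod.mk.inj he).2
  by_cases h1 : r = σ p
  · left; rw [← h1, he1]
  · right
    have h2 : r ≠ q := by
      rintro rfl
      exact (not_mem_nearEnds.1 h.1).1 he1
    have h3 : r ≠ σ q := by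
      rintro rfl
      exact (not_mem_nearEnds.1 h.2.1).1 he1
    refine ⟨r.2, ?_⟩
    have : (p.1, r.2) = r := by rw [← he1]
    rw [this, e5 r hr h2 h1 h3, he2]

open Classical in
theorem card_not_switchable_le (σ : Pairing (V × Fin (m + 1))) (p : V × Fin (m + 1)) :
    Fintype.card V * (m + 1) ≤ (Finset.univ.filter (Switchable σ p)).card +
      (2 * ((2 * m + 4) * (m + 1)) + (badPoints σ).card) := by
  set A := nearEnds σ p ×ˢ (Finset.univ : Finset (Fin (m + 1))) with hA
  have hAc : A.card ≤ (2 * m + 4) * (m + 1) := by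
    rw [hA, Finset.card_product, Finset.card_univ, Fintype.card_fin]
    exact Nat.mul_le_mul_right _ (card_nearEnds_le σ p)
  have hcover : (Finset.univ : Finset (V × Fin (m + 1))) ⊆
      Finset.univ.filter (Switchable σ p) ∪ (A ∪ A.image σ ∪ badPoints σ) := by
    intro q _
    by_cases hq : Switchable σ p q
    · exact Finset.mem_union_left _ (Finset.mem_filter.2 ⟨Finset.mem_univ _, hq⟩)
    refine Finset.mem_union_right _ ?_
    simp only [Finset.mem_union]
    by_cases h1 : q.1 ∈ nearEnds σ p
    · exact Or.inl (Or.inl (Finset.mem_product.2 ⟨h1, Finset.mem_univ _⟩))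
    by_cases h2 : (σ q).1 ∈ nearEnds σ p
    · exact Or.inl (Or.inr (Finset.mem_image.2 ⟨σ q, Finset.mem_product.2 ⟨h2, Finset.mem_univ _⟩,
        σ.apply_apply q⟩))
    have h3 : q.1 = (σ q).1 := by
      by_contra h3
      exact hq ⟨h1, h2, h3⟩
    refine Or.inr (mem_badPoints.2 ⟨σ q, σ.apply_ne q, ?_⟩)
    rw [Pairing.ends, Pairing.ends, σ.apply_apply, h3]
  have h1 := Finset.card_le_card hcover
  rw [Finset.card_univ, Fintype.card_prod, Fintype.card_fin] at h1
  have h2 := Finset.card_union_le (Finset.univ.filter (Switchable σ p))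
    (A ∪ A.image σ ∪ badPoints σ)
  have h3 := Finset.card_union_le (A ∪ A.image σ) (badPoints σ)
  have h4 := Finset.card_union_le A (A.image σ)
  have h5 : (A.image σ).card ≤ A.card := Finset.card_image_le
  omega

end Switch

variable [Fintype V]

open Classical in
/-- The pairings with at most `j` half-edges on loops and multiple edges. -/
noncomputable def fewBad (V : Type*) [Fintype V] (m j : ℕ) : Finset (Pairing (V × Fin (m + 1))) :=
  Finset.univ.filter fun σ => (badPoints σ).card ≤ j

open Classical in
-- Double counting of switchings. A pairing with `j + 1` bad points admits at least `N / 2`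
-- switchings at a chosen bad point, each leading to at most `j` bad points. Each resulting pairing
-- arises at most `N * 2 * (m + 1) ^ 2` times.
theorem card_fewBad_succ_le {j K : ℕ} (hj : j + 1 ≤ K) (hV : 0 < Fintype.card V)
    (hK : 2 * (2 * ((2 * m + 4) * (m + 1)) + K) ≤ Fintype.card V * (m + 1)) :
    (fewBad V m (j + 1)).card ≤ (1 + 4 * (m + 1) ^ 2) * (fewBad V m j).card := by
  set N := Fintype.card V * (m + 1) with hN
  have hN0 : 0 < N := by positivity
  set S := (Finset.univ : Finset (Pairing (V × Fin (m + 1)))).filter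
    fun σ => (badPoints σ).card = j + 1 with hS
  have hsub : fewBad V m (j + 1) ⊆ fewBad V m j ∪ S := fun σ hσ => by
    have := (Finset.mem_filter.1 hσ).2
    rw [Finset.mem_union]
    rcases Nat.le_succ_iff.1 this with h | h
    · exact Or.inl (Finset.mem_filter.2 ⟨Finset.mem_univ _, h⟩)
    · exact Or.inr (Finset.mem_filter.2 ⟨Finset.mem_univ _, h⟩)
  have hbad : ∀ σ ∈ S, ∃ p, p ∈ badPoints σ := fun σ hσ =>
    Finset.card_pos.1 (by rw [(Finset.mem_filter.1 hσ).2]; omega)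
  have : Nonempty (V × Fin (m + 1)) := Fintype.card_pos_iff.1
    (by rw [Fintype.card_prod, Fintype.card_fin]; exact hN0)
  choose! c hc using hbad
  -- The data `(σ p, q)` suffice to reverse a switching, because conjugation by their transposition
  -- is an involution; `W τ` contains all data that can lead to `τ`.
  set W : Pairing (V × Fin (m + 1)) → Finset ((V × Fin (m + 1)) × (V × Fin (m + 1))) := fun τ =>
    Finset.univ.biUnion fun q => ((insert (τ q).1
      (Finset.univ.image fun i => (τ ((τ q).1, i)).1)) ×ˢ Finset.univ) ×ˢ {q} with hW
  have hWcard : ∀ τ, (W τ).card ≤ N * (2 * (m + 1) ^ 2) := fun τ => by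
    refine Finset.card_biUnion_le.trans ((Finset.sum_le_card_nsmul _ _ (2 * (m + 1) ^ 2)
      fun q _ => ?_).trans ?_)
    · rw [Finset.card_product, Finset.card_product, Finset.card_singleton, mul_one,
        Finset.card_univ, Fintype.card_fin]
      have h1 := Finset.card_insert_le (τ q).1
        ((Finset.univ : Finset (Fin (m + 1))).image fun i => (τ ((τ q).1, i)).1)
      have h2 : ((Finset.univ : Finset (Fin (m + 1))).image fun i => (τ ((τ q).1, i)).1).card ≤
        m + 1 := Finset.card_image_le.trans (by simp)
      nlinarith
    · rw [Finset.card_univ, Fintype.card_prod, Fintype.card_fin, smul_eq_mul]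
  have hmap : (S.sigma fun σ => Finset.univ.filter (Switchable σ (c σ))).card ≤
      ((fewBad V m j).sigma W).card := by
    refine Finset.card_le_card_of_injOn
      (fun x => ⟨switch x.1 (c x.1) x.2, (x.1 (c x.1), x.2)⟩) ?_ ?_
    · rintro ⟨σ, q⟩ hx
      obtain ⟨hσ, hq⟩ := Finset.mem_sigma.1 hx
      have hq := (Finset.mem_filter.1 hq).2
      refine Finset.mem_coe.2 (Finset.mem_sigma.2 ⟨Finset.mem_filter.2 ⟨Finset.mem_univ _, ?_⟩, ?_⟩)
      · have h1 := hq.card_badPoints_lt (hc σ hσ)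
        have h2 := (Finset.mem_filter.1 hσ).2
        simp only at h1 h2 ⊢
        omega
      · simp only [hW, Finset.mem_biUnion, Finset.mem_univ, true_and, Finset.mem_product,
          Finset.mem_insert, Finset.mem_image, Finset.mem_singleton, and_true]
        refine ⟨q, ?_, rfl⟩
        rcases hq.fst_apply_eq (hc σ hσ) with h | ⟨i, h⟩
        · exact Or.inl h
        · exact Or.inr ⟨i, h.symm⟩
    · rintro ⟨σ, q⟩ - ⟨σ', q'⟩ - h
      simp only [Sigma.mk.injEq, heq_eq_eq, Prod.mk.injEq] at h
      obtain ⟨h1, h2, rfl⟩ := h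
      have h3 := congrArg (Pairing.conj (Equiv.swap (σ (c σ)) q)) h1
      have : σ = σ' := by
        rw [switch, switch, Pairing.conj_swap_conj_swap, h2, Pairing.conj_swap_conj_swap] at h3
        exact h3
      rw [this]
  rw [Finset.card_sigma, Finset.card_sigma] at hmap
  have hgood : ∀ σ ∈ S, N ≤ 2 * (Finset.univ.filter (Switchable σ (c σ))).card := fun σ hσ => by
    have h1 := card_not_switchable_le σ (c σ)
    have h2 := (Finset.mem_filter.1 hσ).2
    rw [← hN, h2] at h1
    omega
  have h1 : S.card * N ≤ 2 * ∑ σ ∈ S, (Finset.univ.filter (Switchable σ (c σ))).card := by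
    rw [Finset.mul_sum, ← smul_eq_mul, ← Finset.sum_const]
    exact Finset.sum_le_sum hgood
  have h2 : ∑ τ ∈ fewBad V m j, (W τ).card ≤ (fewBad V m j).card * (N * (2 * (m + 1) ^ 2)) := by
    rw [← smul_eq_mul, ← Finset.sum_const]
    exact Finset.sum_le_sum fun τ _ => hWcard τ
  have h3 : S.card ≤ 4 * (m + 1) ^ 2 * (fewBad V m j).card := by
    refine Nat.le_of_mul_le_mul_right ?_ hN0
    nlinarith
  have h4 := (Finset.card_le_card hsub).trans (Finset.card_union_le _ _)
  nlinarith

theorem card_fewBad_le {K : ℕ} (hV : 0 < Fintype.card V)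
    (hK : 2 * (2 * ((2 * m + 4) * (m + 1)) + K) ≤ Fintype.card V * (m + 1)) {j : ℕ} (hj : j ≤ K) :
    (fewBad V m j).card ≤ (1 + 4 * (m + 1) ^ 2) ^ j * (fewBad V m 0).card := by
  induction j with
  | zero => simp
  | succ j ih =>
    have h1 := card_fewBad_succ_le (m := m) hj hV hK
    have h2 := Nat.mul_le_mul_left (1 + 4 * (m + 1) ^ 2) (ih (by omega))
    rw [pow_succ']
    nlinarith

open Classical in
-- An exploration of two steps, first `p` and then `q`. The second query is live unless `σ p = q`,
-- which is therefore made the bad answer at the first step; the Chernoff bound with `k = 1` gives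
-- `4e / n ≤ 12 / n`.
theorem card_parallel_le {p q : V × Fin (m + 1)} (hpq : p ≠ q) (hV : 8 ≤ Fintype.card V) :
    ((Finset.univ.filter fun σ : Pairing (V × Fin (m + 1)) => (σ q).1 = (σ p).1).card : ℝ) ≤
      12 / Fintype.card V * Fintype.card (Pairing (V × Fin (m + 1))) := by
  have hV' : (8 : ℝ) ≤ Fintype.card V := by exact_mod_cast hV
  set z : Pairing (V × Fin (m + 1)) → ℕ → V × Fin (m + 1) := fun _ t => if t = 0 then p else q
    with hzdef
  have hz : Adapted z := fun t σ τ _ => rfl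
  set B : ℕ → Pairing (V × Fin (m + 1)) → Finset (V × Fin (m + 1)) := fun t σ =>
    if t = 0 then {q} else {(σ p).1} ×ˢ Finset.univ with hB
  have key := hz.card_badSteps_le B (fun t σ τ h => by
      simp only [hB]
      split_ifs with ht
      · rfl
      · have := h 0 (by omega)
        simp only [hzdef, if_true] at this
        rw [this]) (T := 2) (b := m + 1) (k := 1) (u := Fintype.card V * (m + 1) / 2)
    (by positivity) (by omega) (by omega) (by omega) (fun t _ σ => by
      simp only [hB]
      split_ifs
      · simp
      · simp) (by
      rw [Fintype.card_prod, Fintype.card_fin]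
      push_cast
      have : (0 : ℝ) ≤ m := Nat.cast_nonneg _
      nlinarith)
  refine le_trans (Nat.cast_le.2 (Finset.card_le_card fun σ hσ => ?_)) (key.trans ?_)
  · have hσ := (Finset.mem_filter.1 hσ).2
    refine Finset.mem_filter.2 ⟨Finset.mem_univ _, Finset.card_pos.2 ?_⟩
    by_cases h : σ p = q
    · refine ⟨0, Finset.mem_filter.2 ⟨by simp, ?_, ?_⟩⟩
      · simp [Live, revealed]
      · simp [hB, hzdef, h]
    · refine ⟨1, Finset.mem_filter.2 ⟨by simp, ?_, ?_⟩⟩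
      · simp [Live, revealed, hzdef, hpq.symm, Ne.symm h]
      · simp only [hB, hzdef, one_ne_zero, if_false]
        exact Finset.mem_product.2 ⟨Finset.mem_singleton.2 hσ, Finset.mem_univ _⟩
  · refine mul_le_mul_of_nonneg_right ?_ (Nat.cast_nonneg _)
    rw [pow_one, div_le_div_iff₀ (by positivity) (by positivity)]
    push_cast
    have e1 : Real.exp 1 ≤ 3 := by linarith [Real.exp_one_lt_d9]
    have : 0 ≤ ((m : ℝ) + 1) * Fintype.card V := by positivity
    nlinarith

open Classical in
theorem sum_card_badPoints_le (hV : 8 ≤ Fintype.card V) :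
    (∑ σ : Pairing (V × Fin (m + 1)), ((badPoints σ).card : ℝ)) ≤
      12 * (m + 1) ^ 2 * Fintype.card (Pairing (V × Fin (m + 1))) := by
  have hV' : (8 : ℝ) ≤ Fintype.card V := by exact_mod_cast hV
  set Ω := (Fintype.card (Pairing (V × Fin (m + 1))) : ℝ)
  have h1 : ∀ σ : Pairing (V × Fin (m + 1)), ((badPoints σ).card : ℝ) ≤
      ∑ p : V × Fin (m + 1), ∑ i : Fin (m + 1),
        if (p.1, i) ≠ p ∧ (σ (p.1, i)).1 = (σ p).1 then (1 : ℝ) else 0 := fun σ => by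
    rw [badPoints, Finset.card_filter, Nat.cast_sum]
    refine Finset.sum_le_sum fun p _ => ?_
    split_ifs with h
    · obtain ⟨q, hq, he⟩ := h
      have he1 : q.1 = p.1 := (Prod.mk.inj he).1
      have he2 : (σ q).1 = (σ p).1 := (Prod.mk.inj he).2
      have hq' : (p.1, q.2) = q := by rw [← he1]
      refine le_trans ?_ (Finset.single_le_sum (fun i _ => ?_) (Finset.mem_univ q.2))
      · rw [hq', if_pos ⟨hq, he2⟩, Nat.cast_one]
      · split_ifs <;> norm_num
    · rw [Nat.cast_zero]
      exact Finset.sum_nonneg fun i _ => by split_ifs <;> norm_num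
  refine (Finset.sum_le_sum fun σ _ => h1 σ).trans ?_
  rw [Finset.sum_comm]
  have h2 : ∀ p : V × Fin (m + 1), ∑ σ : Pairing (V × Fin (m + 1)), ∑ i : Fin (m + 1),
      (if (p.1, i) ≠ p ∧ (σ (p.1, i)).1 = (σ p).1 then (1 : ℝ) else 0) ≤
        (m + 1) * (12 / Fintype.card V * Ω) := fun p => by
    rw [Finset.sum_comm]
    refine (Finset.sum_le_card_nsmul _ _ (12 / Fintype.card V * Ω) fun i _ => ?_).trans ?_
    · by_cases hi : (p.1, i) = p
      · simp only [hi, ne_eq, not_true_eq_false, false_and, if_false, Finset.sum_const_zero]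
        positivity
      · simp only [ne_eq, hi, not_false_eq_true, true_and]
        rw [Finset.sum_boole]
        exact card_parallel_le (Ne.symm hi) hV
    · simp
  refine (Finset.sum_le_card_nsmul _ _ _ fun p _ => h2 p).trans ?_
  rw [Finset.card_univ, Fintype.card_prod, Fintype.card_fin, nsmul_eq_mul]
  push_cast
  refine le_of_eq ?_
  field_simp

/-- The probability that a random pairing is simple is bounded below. -/
theorem exists_card_le_card_fewBad (m : ℕ) : ∃ c : ℝ, 0 < c ∧ ∀ᶠ n : ℕ in atTop,
    c * Fintype.card (Pairing (Fin n × Fin (m + 1))) ≤ (fewBad (Fin n) m 0).card := by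
  classical
  -- Twice the bound on the mean number of bad points: by Markov at least half of the pairings have
  -- at most `K` of them. Descending from `K` to zero costs a factor independent of `n`.
  set K := 24 * (m + 1) ^ 2 with hK
  refine ⟨1 / 2 / (1 + 4 * ((m : ℝ) + 1) ^ 2) ^ K, by positivity, ?_⟩
  filter_upwards [eventually_ge_atTop 8,
    eventually_ge_atTop (2 * (2 * ((2 * m + 4) * (m + 1)) + K))] with n hn1 hn2
  have h1 := card_fewBad_le (V := Fin n) (m := m) (K := K) (by simp; omega)
    (by rw [Fintype.card_fin]; nlinarith) le_rfl
  have h2 : ((fewBad (Fin n) m K).card : ℝ) ≤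
      (1 + 4 * ((m : ℝ) + 1) ^ 2) ^ K * (fewBad (Fin n) m 0).card := by exact_mod_cast h1
  have h3 := sum_card_badPoints_le (V := Fin n) (m := m) (by simpa using hn1)
  set Ω := Fintype.card (Pairing (Fin n × Fin (m + 1)))
  set A := fewBad (Fin n) m K
  have hKr : (K : ℝ) = 24 * ((m : ℝ) + 1) ^ 2 := by rw [hK]; push_cast; rfl
  have h4 : (Aᶜ.card : ℝ) * K ≤ ∑ σ : Pairing (Fin n × Fin (m + 1)), ((badPoints σ).card : ℝ) := by
    rw [← nsmul_eq_mul, ← Finset.sum_const]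
    refine (Finset.sum_le_sum fun σ hσ => ?_).trans
      (Finset.sum_le_univ_sum_of_nonneg fun σ => Nat.cast_nonneg _)
    rw [Finset.mem_compl] at hσ
    have : ¬ (badPoints σ).card ≤ K := fun h => hσ (Finset.mem_filter.2 ⟨Finset.mem_univ _, h⟩)
    exact_mod_cast (not_le.1 this).le
  have h5 : (A.card : ℝ) + Aᶜ.card = Ω := by exact_mod_cast Finset.card_add_card_compl A
  have h6 : (Aᶜ.card : ℝ) ≤ Ω / 2 := by
    have hpos : (0 : ℝ) < K := by rw [hKr]; positivity
    refine le_of_mul_le_mul_right (h4.trans (h3.trans (le_of_eq ?_))) hpos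
    rw [hKr]; ring
  rw [div_mul_eq_mul_div, div_le_iff₀ (by positivity)]
  linarith

end Simple

/-! ### Every regular graph has equally many simple pairings. -/

section Fibre

variable {V : Type*} {m : ℕ}

theorem Pairing.IsSimple.fst_apply_ne {ι : Type*} {σ : Pairing (V × ι)} (h : σ.IsSimple)
    (p : V × ι) : (σ p).1 ≠ p.1 := fun he =>
  σ.apply_ne p (h (by rw [Pairing.ends, Pairing.ends, σ.apply_apply, he]))

theorem Pairing.IsSimple.bijective {σ : Pairing (V × Fin (m + 1))} (h : σ.IsSimple) (v : V) :
    Function.Bijective (fun i => (⟨(σ (v, i)).1, (h.fst_apply_ne (v, i)).symm, i, rfl⟩ :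
      σ.graph.neighborSet v)) := by
  refine ⟨fun i j hij => ?_, ?_⟩
  · have : (σ (v, i)).1 = (σ (v, j)).1 := congrArg Subtype.val hij
    exact congrArg Prod.snd (h (show σ.ends (v, i) = σ.ends (v, j) by
      rw [Pairing.ends, Pairing.ends, this]))
  · rintro ⟨w, -, i, rfl⟩
    exact ⟨i, rfl⟩

/-- The simple pairings with a given graph correspond to the labellings of the neighbours. -/
noncomputable def Pairing.labelling (G : SimpleGraph V)
    (σ : {σ : Pairing (V × Fin (m + 1)) // σ.IsSimple ∧ σ.graph = G}) (v : V) :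
    Fin (m + 1) ≃ G.neighborSet v :=
  (Equiv.ofBijective _ (σ.2.1.bijective v)).trans (Equiv.setCongr (by rw [σ.2.2]))

/-- The pairing that belongs to a labelling of the neighbours. -/
noncomputable def Pairing.ofLabelling (G : SimpleGraph V)
    (l : ∀ v, Fin (m + 1) ≃ G.neighborSet v) : Pairing (V × Fin (m + 1)) :=
  ⟨fun p => (l p.1 p.2, (l (l p.1 p.2)).symm ⟨p.1, (l p.1 p.2).2.symm⟩), by
    rintro ⟨v, i⟩
    have h : ∀ y : G.neighborSet (l v i), y = ⟨v, (l v i).2.symm⟩ →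
        ((y : V), (l y).symm ⟨l v i, y.2.symm⟩) = (v, i) := by
      rintro _ rfl
      exact congrArg (Prod.mk v) ((l v).symm_apply_apply i)
    exact h _ ((l (l v i)).apply_symm_apply _), fun p h =>
      (l p.1 p.2).2.ne (congrArg Prod.fst h).symm⟩

theorem Pairing.ofLabelling_apply (G : SimpleGraph V)
    (l : ∀ v, Fin (m + 1) ≃ G.neighborSet v) (p : V × Fin (m + 1)) :
    (Pairing.ofLabelling G l p).1 = l p.1 p.2 := rfl

/-- In a simple pairing the partner of `(v, i)` is the only half-edge at its vertex leading back to
`v`. So the end vertices alone determine the pairing, and any labelling of the neighbours can occur.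
-/
theorem Pairing.labelling_bijective (G : SimpleGraph V) :
    Function.Bijective (Pairing.labelling (m := m) G) := by
  refine ⟨?_, fun l => ?_⟩
  · rintro ⟨σ, hσ⟩ ⟨τ, hτ⟩ h
    have h1 : ∀ p, (σ p).1 = (τ p).1 := fun p =>
      congrArg (fun l => (l p.1 p.2 : V)) h
    refine Subtype.ext (Pairing.ext fun p => hσ.1 ?_)
    rw [Pairing.ends, Pairing.ends, σ.apply_apply, h1 (τ p), τ.apply_apply, h1 p]
  · have hs : (Pairing.ofLabelling G l).IsSimple := by
      rintro ⟨v, i⟩ ⟨w, j⟩ h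
      have h1 : v = w := (Prod.mk.inj h).1
      subst h1
      have h2 : (l v i : V) = l v j := (Prod.mk.inj h).2
      rw [(l v).injective (Subtype.ext h2)]
    have hg : (Pairing.ofLabelling G l).graph = G := by
      ext v w
      constructor
      · rintro ⟨-, i, rfl⟩
        exact (l v i).2
      · intro h
        exact ⟨h.ne, (l v).symm ⟨w, h⟩, by simp [Pairing.ofLabelling_apply]⟩
    exact ⟨⟨_, hs, hg⟩, funext fun v => Equiv.ext fun i => Subtype.ext rfl⟩

theorem mem_regularGraphs {d n : ℕ} {G : SimpleGraph (Fin n)} :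
    G ∈ regularGraphs d n ↔ ∀ v, Nat.card (G.neighborSet v) = d := by
  classical
  simp only [regularGraphs, Set.mem_ofPred_eq, SimpleGraph.IsRegularOfDegree,
    ← SimpleGraph.card_neighborSet_eq_degree, Nat.card_eq_fintype_card]

theorem Pairing.IsSimple.graph_mem {n : ℕ} {σ : Pairing (Fin n × Fin (m + 1))} (h : σ.IsSimple) :
    σ.graph ∈ regularGraphs (m + 1) n := by
  rw [mem_regularGraphs]
  intro v
  rw [← Nat.card_congr (Equiv.ofBijective _ (h.bijective v)), Nat.card_eq_fintype_card,
    Fintype.card_fin]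

/-- The map from simple pairings to regular graphs is uniform. -/
theorem card_simple_pairings {n : ℕ} (Q : SimpleGraph (Fin n) → Prop) :
    Nat.card {σ : Pairing (Fin n × Fin (m + 1)) // σ.IsSimple ∧ Q σ.graph} =
      {G ∈ regularGraphs (m + 1) n | Q G}.ncard *
        Nat.card (Fin n → Equiv.Perm (Fin (m + 1))) := by
  set A := {σ : Pairing (Fin n × Fin (m + 1)) // σ.IsSimple ∧ Q σ.graph}
  set S := {G ∈ regularGraphs (m + 1) n | Q G}
  let f : A → S := fun σ => ⟨σ.1.graph, σ.2.1.graph_mem, σ.2.2⟩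
  have hfib : ∀ G : S, Nonempty ({σ : A // f σ = G} ≃ (Fin n → Equiv.Perm (Fin (m + 1)))) := by
    rintro ⟨G, hG, hQ⟩
    have e1 : {σ : A // f σ = ⟨G, hG, hQ⟩} ≃
        {σ : Pairing (Fin n × Fin (m + 1)) // σ.IsSimple ∧ σ.graph = G} :=
      { toFun := fun σ => ⟨σ.1.1, σ.1.2.1, congrArg Subtype.val σ.2⟩
        invFun := fun σ => ⟨⟨σ.1, σ.2.1, by rw [σ.2.2]; exact hQ⟩, Subtype.ext σ.2.2⟩
        left_inv := fun σ => rfl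
        right_inv := fun σ => rfl }
    have e2 : ∀ v, Nonempty (G.neighborSet v ≃ Fin (m + 1)) := fun v => by
      rw [mem_regularGraphs] at hG
      exact ⟨Finite.equivFinOfCardEq (hG v)⟩
    exact ⟨(e1.trans (Equiv.ofBijective _ (Pairing.labelling_bijective G))).trans
      (Equiv.piCongrRight fun v => Equiv.equivCongr (Equiv.refl _) (e2 v).some)⟩
  rw [Nat.card_congr (Equiv.sigmaFiberEquiv f).symm,
    Nat.card_congr (Equiv.sigmaCongrRight fun G => (hfib G).some),
    Nat.card_congr (Equiv.sigmaEquivProd _ _), Nat.card_prod, Nat.card_coe_set_eq]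

end Fibre

/-! ### Flow through a vertex in a regular graph of bounded diameter. -/

section Flow

theorem flowThrough_le_one {V : Type*} (G : SimpleGraph V) (a b v : V) :
    flowThrough G a b v ≤ 1 := by
  rw [flowThrough]
  rcases Nat.eq_zero_or_pos (geodesics G a b).ncard with h | h
  · rw [h]; simp
  · rw [div_le_one (by exact_mod_cast h)]
    exact_mod_cast Set.ncard_le_ncard (Set.sep_subset _ _) (Set.finite_of_ncard_pos h)

/-- A geodesic through `v` splits there into walks to both end points, so it would be too long. -/
theorem flowThrough_eq_zero {V : Type*} {G : SimpleGraph V} {a b v : V}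
    (h : G.dist a b < G.dist v a + G.dist v b) : flowThrough G a b v = 0 := by
  classical
  have : {p ∈ geodesics G a b | v ∈ p.support} = ∅ := by
    ext p
    simp only [Set.mem_ofPred_eq, Set.mem_empty_iff_false, iff_false, not_and]
    intro hp hv
    have h1 := congrArg SimpleGraph.Walk.length (p.take_spec hv)
    rw [SimpleGraph.Walk.length_append] at h1
    have h2 := SimpleGraph.dist_le (p.takeUntil v hv)
    have h3 := SimpleGraph.dist_le (p.dropUntil v hv)
    rw [SimpleGraph.dist_comm] at h2
    have h4 : p.length = G.dist a b := hp
    omega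
  rw [flowThrough, this]
  simp

variable {n m : ℕ} {G : SimpleGraph (Fin n)}

open Classical in
/-- The vertices at distance `i` from `v`. -/
noncomputable def sphere (G : SimpleGraph (Fin n)) (v : Fin n) (i : ℕ) : Finset (Fin n) :=
  Finset.univ.filter fun w => G.dist v w = i

theorem mem_sphere {v w : Fin n} {i : ℕ} : w ∈ sphere G v i ↔ G.dist v w = i := by
  simp [sphere]

theorem exists_adj_dist_eq (hG : G.Connected) {v w : Fin n} {i : ℕ} (h : G.dist v w = i + 1) :
    ∃ u, G.Adj w u ∧ G.dist v u = i := by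
  obtain ⟨p, hp⟩ := hG.exists_walk_length_eq_dist w v
  rw [SimpleGraph.dist_comm, h] at hp
  cases p with
  | nil => simp at hp
  | @cons _ u _ hadj q =>
    refine ⟨u, hadj, ?_⟩
    rw [SimpleGraph.Walk.length_cons] at hp
    have h1 := SimpleGraph.dist_le q
    rw [SimpleGraph.dist_comm] at h1
    have h2 := hG.dist_triangle (u := v) (v := u) (w := w)
    have h3 : G.dist u w ≤ 1 := SimpleGraph.dist_le hadj.symm.toWalk
    omega

open Classical in
theorem card_neighborFinset_eq (hG : G ∈ regularGraphs (m + 1) n) (v : Fin n) :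
    (G.neighborFinset v).card = m + 1 := by
  rw [← mem_regularGraphs.1 hG v, SimpleGraph.card_neighborFinset_eq_degree,
    ← SimpleGraph.card_neighborSet_eq_degree, Nat.card_eq_fintype_card]

/-- A vertex at distance `i + 1` spends one of its `m + 1` edges on a neighbour at distance `i`. -/
theorem card_sphere_succ_le (hreg : G ∈ regularGraphs (m + 1) n) (hG : G.Connected) (v : Fin n)
    (i : ℕ) : (sphere G v (i + 2)).card ≤ m * (sphere G v (i + 1)).card := by
  classical
  have hsub : sphere G v (i + 2) ⊆
      (sphere G v (i + 1)).biUnion fun u => G.neighborFinset u \ sphere G v i := fun w hw => by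
    obtain ⟨u, hu, hd⟩ := exists_adj_dist_eq hG (mem_sphere.1 hw)
    refine Finset.mem_biUnion.2 ⟨u, mem_sphere.2 hd, Finset.mem_sdiff.2
      ⟨(G.mem_neighborFinset u w).2 hu.symm, fun h => ?_⟩⟩
    rw [mem_sphere] at h hw
    omega
  refine (Finset.card_le_card hsub).trans (Finset.card_biUnion_le.trans ?_)
  refine (Finset.sum_le_card_nsmul _ _ m fun u hu => ?_).trans (by rw [smul_eq_mul, mul_comm])
  obtain ⟨x, hx, hd⟩ := exists_adj_dist_eq hG (mem_sphere.1 hu)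
  have h1 : G.neighborFinset u \ sphere G v i ⊆ (G.neighborFinset u).erase x := fun w hw => by
    obtain ⟨h2, h3⟩ := Finset.mem_sdiff.1 hw
    refine Finset.mem_erase.2 ⟨?_, h2⟩
    rintro rfl
    exact h3 (mem_sphere.2 hd)
  have h2 := Finset.card_le_card h1
  rwa [Finset.card_erase_of_mem ((G.mem_neighborFinset u x).2 hx), card_neighborFinset_eq hreg,
    Nat.add_sub_cancel] at h2

theorem card_sphere_le (hm : 2 ≤ m) (hreg : G ∈ regularGraphs (m + 1) n) (hG : G.Connected)
    (v : Fin n) (i : ℕ) : (sphere G v i).card ≤ 2 * m ^ i := by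
  classical
  rcases i with _ | i
  · have : sphere G v 0 ⊆ {v} := fun w hw => by
      rw [mem_sphere, (hG v w).dist_eq_zero_iff] at hw
      simp [hw]
    have := Finset.card_le_card this
    simp at this ⊢
    omega
  induction i with
  | zero =>
    have : sphere G v 1 ⊆ G.neighborFinset v := fun w hw => by
      rw [G.mem_neighborFinset, ← SimpleGraph.dist_eq_one_iff_adj]
      exact mem_sphere.1 hw
    have := Finset.card_le_card this
    rw [card_neighborFinset_eq hreg] at this
    simp only [zero_add, pow_one]
    omega
  | succ i ih =>
    refine (card_sphere_succ_le hreg hG v i).trans ((Nat.mul_le_mul_left m ih).trans ?_)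
    rw [pow_succ m (i + 1)]
    nlinarith

theorem sum_pow_le (hm : 2 ≤ m) (D : ℕ) : ∑ k ∈ Finset.range (D + 1), m ^ k ≤ 2 * m ^ D := by
  induction D with
  | zero => simp
  | succ D ih =>
    rw [Finset.sum_range_succ]
    have : 2 * m ^ D ≤ m ^ (D + 1) := by rw [pow_succ']; exact Nat.mul_le_mul_right _ hm
    omega

open Classical in
-- For distance sum `k` there are `k + 1` splittings, each with at most `4 * m ^ k` pairs, and the
-- geometric sum is dominated by its last term. The factor `D + 1` becomes one of the three
-- logarithms.
theorem card_pairs_le (hm : 2 ≤ m) (hreg : G ∈ regularGraphs (m + 1) n) (hG : G.Connected)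
    (v : Fin n) (D : ℕ) :
    ((Finset.univ : Finset (Fin n × Fin n)).filter
      fun p => G.dist v p.1 + G.dist v p.2 ≤ D).card ≤ 8 * (D + 1) * m ^ D := by
  have hsub : ((Finset.univ : Finset (Fin n × Fin n)).filter
      fun p => G.dist v p.1 + G.dist v p.2 ≤ D) ⊆
      (Finset.range (D + 1)).biUnion fun k =>
        (Finset.HasAntidiagonal.antidiagonal k).biUnion fun q => sphere G v q.1 ×ˢ sphere G v q.2 := fun p hp => by
    simp only [Finset.mem_biUnion, Finset.mem_product, mem_sphere, Finset.mem_range]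
    exact ⟨_, Nat.lt_succ_of_le (Finset.mem_filter.1 hp).2, (G.dist v p.1, G.dist v p.2),
      Finset.HasAntidiagonal.mem_antidiagonal.2 rfl, rfl, rfl⟩
  refine (Finset.card_le_card hsub).trans (Finset.card_biUnion_le.trans ?_)
  have h1 : ∀ k ∈ Finset.range (D + 1), ((Finset.HasAntidiagonal.antidiagonal k).biUnion fun q =>
      sphere G v q.1 ×ˢ sphere G v q.2).card ≤ 4 * (D + 1) * m ^ k := fun k hk => by
    refine Finset.card_biUnion_le.trans ?_
    refine (Finset.sum_le_card_nsmul _ _ (4 * m ^ k) fun q hq => ?_).trans ?_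
    · rw [Finset.card_product]
      refine (Nat.mul_le_mul (card_sphere_le hm hreg hG v _)
        (card_sphere_le hm hreg hG v _)).trans (le_of_eq ?_)
      rw [← Finset.HasAntidiagonal.mem_antidiagonal.1 hq, pow_add]
      ring
    · rw [Finset.Nat.card_antidiagonal, smul_eq_mul]
      have := Finset.mem_range.1 hk
      calc (k + 1) * (4 * m ^ k) ≤ (D + 1) * (4 * m ^ k) := Nat.mul_le_mul_right _ (by omega)
        _ = _ := by ring
  refine (Finset.sum_le_sum h1).trans ?_
  rw [← Finset.mul_sum]
  refine (Nat.mul_le_mul_left _ (sum_pow_le hm D)).trans (le_of_eq ?_)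
  ring

/-- In a connected regular graph of diameter at most `D`, only the pairs whose distances from `v`
add up to at most `D` contribute to the flow through `v`. -/
theorem maxVertexFlow_le (hm : 2 ≤ m) (hreg : G ∈ regularGraphs (m + 1) n) (hG : G.Connected)
    {D : ℕ} (hD : ∀ a b, G.dist a b ≤ D) :
    maxVertexFlow G ≤ 8 * (D + 1) * (m : ℝ) ^ D := by
  classical
  refine Real.iSup_le (fun v => ?_) (by positivity)
  have h1 : ∀ a b, flowThrough G a b v ≤ if G.dist v a + G.dist v b ≤ D then 1 else 0 :=
    fun a b => by
      split_ifs with h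
      · exact flowThrough_le_one G a b v
      · exact (flowThrough_eq_zero ((hD a b).trans_lt (not_le.1 h))).le
  calc vertexFlow G v ≤ ∑ a : Fin n, ∑ b ∈ Finset.Ioi a,
        (if G.dist v a + G.dist v b ≤ D then (1 : ℝ) else 0) :=
        Finset.sum_le_sum fun a _ => Finset.sum_le_sum fun b _ => h1 a b
    _ ≤ ∑ a : Fin n, ∑ b : Fin n, (if G.dist v a + G.dist v b ≤ D then (1 : ℝ) else 0) :=
        Finset.sum_le_sum fun a _ => Finset.sum_le_univ_sum_of_nonneg fun b => by
          split_ifs <;> norm_num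
    _ = (((Finset.univ : Finset (Fin n × Fin n)).filter
      fun p => G.dist v p.1 + G.dist v p.2 ≤ D).card : ℝ) := by
        rw [← Finset.sum_boole, ← Finset.univ_product_univ, Finset.sum_product]
    _ ≤ _ := by exact_mod_cast card_pairs_le hm hreg hG v D

end Flow

/-! ### Transfer to regular graphs and conclusion. -/

section Main

theorem nonempty_pairing {P : Type*} [Fintype P] (h : Even (Fintype.card P)) :
    Nonempty (Pairing P) := by
  obtain ⟨k, hk⟩ := h
  have e : P ≃ Fin k × Bool := Fintype.equivOfCardEq (by simp [hk]; ring)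
  exact ⟨⟨fun p => e.symm ((e p).1, !(e p).2), fun p => by simp, fun p h => by
    have := congrArg (fun x => (e x).2) h
    simp at this⟩⟩

theorem exists_radius {m : ℕ} (hm : 2 ≤ m) {x : ℝ} (hx : 1 ≤ x) :
    ∃ R : ℕ, x ≤ (m : ℝ) ^ R ∧ (m : ℝ) ^ R ≤ m * x := by
  obtain ⟨r, h1, h2⟩ := exists_nat_pow_near hx (y := (m : ℝ)) (by exact_mod_cast hm)
  exact ⟨r + 1, h2.le, by rw [pow_succ']; gcongr⟩

/-- With high probability the distances in a random regular graph are at most `2 * R`, where `m ^ R`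
is about `√n * log n`. -/
theorem eventually_card_far_graphs_le {m : ℕ} (hm : 2 ≤ m) {ε : ℝ} (hε : 0 < ε) :
    ∀ᶠ n : ℕ in atTop, Even (n * (m + 1)) → 0 < (regularGraphs (m + 1) n).ncard ∧
      ∀ R : ℕ, √n * Real.log n ≤ (m : ℝ) ^ R → (m : ℝ) ^ R ≤ m * (√n * Real.log n) →
        ({G ∈ regularGraphs (m + 1) n | ∃ a b, G.Far a b (2 * R)}.ncard : ℝ) ≤
          ε * (regularGraphs (m + 1) n).ncard := by
  classical
  obtain ⟨c, hc, hev⟩ := exists_card_le_card_fewBad m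
  -- Conditioning on simplicity divides probabilities by at least `c`, so the pairing bound is
  -- invoked with `ε * c`. Evenness ensures that there are pairings at all.
  filter_upwards [hev, eventually_card_exists_far_le hm (mul_pos hε hc)] with n h1 h2 heven
  set L := Nat.card (Fin n → Equiv.Perm (Fin (m + 1)))
  have hL : 0 < L := Nat.card_pos
  have hL' : (0 : ℝ) < L := by exact_mod_cast hL
  have hsimple : (fewBad (Fin n) m 0).card = (regularGraphs (m + 1) n).ncard * L := by
    have := card_simple_pairings (m := m) (n := n) fun _ => True
    simp only [and_true, Set.ofPred_mem_eq] at this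
    rw [← this, Nat.card_eq_fintype_card, Fintype.card_subtype]
    simp only [fewBad, isSimple_iff]
  have hΩ : (0 : ℝ) < Fintype.card (Pairing (Fin n × Fin (m + 1))) := by
    have : Nonempty (Pairing (Fin n × Fin (m + 1))) := nonempty_pairing (by simpa using heven)
    exact_mod_cast Fintype.card_pos
  rw [hsimple, Nat.cast_mul] at h1
  refine ⟨?_, fun R hR1 hR2 => ?_⟩
  · have : (0 : ℝ) < (regularGraphs (m + 1) n).ncard * L := (mul_pos hc hΩ).trans_le h1
    exact_mod_cast pos_of_mul_pos_left this hL'.le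
  · have h3 := card_simple_pairings (m := m) (n := n) fun G => ∃ a b, G.Far a b (2 * R)
    have h4 := h2 R hR1 hR2
    have h5 : Nat.card {σ : Pairing (Fin n × Fin (m + 1)) //
        σ.IsSimple ∧ ∃ a b, σ.graph.Far a b (2 * R)} ≤
        (Finset.univ.filter (fun σ : Pairing (Fin n × Fin (m + 1)) =>
          ∃ a b, σ.graph.Far a b (2 * R))).card := by
      rw [Nat.card_eq_fintype_card, Fintype.card_subtype]
      refine Finset.card_le_card fun σ hσ => ?_
      exact Finset.mem_filter.2 ⟨Finset.mem_univ _, (Finset.mem_filter.1 hσ).2.2⟩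
    rw [h3] at h5
    have h6 := (Nat.cast_le (α := ℝ)).2 h5
    rw [Nat.cast_mul] at h6
    refine le_of_mul_le_mul_right (h6.trans (h4.trans ?_)) hL'
    nlinarith

theorem mainTheorem1 (d : ℕ) (hd : 3 ≤ d) :
    ∃ (C : ℝ) (f : ℕ → ℝ),
      f =o[atTop] (fun n : ℕ => (n : ℝ) * Real.logb d n ^ 3) ∧
      RegularAAS d (fun n G => G.Connected ∧
        maxVertexFlow G ≤ (d : ℝ) ^ C * ((n : ℝ) * Real.logb d n ^ 3) + f n) := by
  obtain ⟨m, rfl⟩ : ∃ m, d = m + 1 := ⟨d - 1, by omega⟩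
  have hm : 2 ≤ m := by omega
  have hm' : (2 : ℝ) ≤ m := by exact_mod_cast hm
  set d : ℝ := ((m + 1 : ℕ) : ℝ) with hdd
  have hd1 : 1 < d := by rw [hdd]; push_cast; linarith
  have hlogd : 0 < Real.log d := Real.log_pos hd1
  -- The factor 56 comes from `8 * (2 * R + 1)` with `R ≤ 3 * log n` and `log n ≥ 1`, the factor `m
  -- ^ 2` from rounding the radius up, and `log d ^ 3` from the change to base `d`. The exponent `C`
  -- is the logarithm of `K` to base `d`.
  set K : ℝ := 56 * m ^ 2 * Real.log d ^ 3 with hK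
  have hK0 : 0 < K := by positivity
  refine ⟨Real.logb d K, fun _ => 0, Asymptotics.isLittleO_zero _ _, ?_⟩
  rw [Real.rpow_logb (by linarith) hd1.ne' hK0]
  rw [RegularAAS, Metric.tendsto_nhds]
  intro ε hε
  rw [Filter.eventually_inf_principal]
  filter_upwards [eventually_card_far_graphs_le hm (half_pos hε),
    tendsto_log_natCast.eventually_ge_atTop 1,
    tendsto_natCast_atTop_atTop.eventually_ge_atTop (m : ℝ),
    eventually_mul_log_pow_le 1 2] with n h1 h2 h3 h4 heven
  obtain ⟨hpos, hfar⟩ := h1 heven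
  have hn0 : (0 : ℝ) < n := by linarith
  have hsq : √(n : ℝ) * √n = n := Real.mul_self_sqrt hn0.le
  have hsq1 : 1 ≤ √(n : ℝ) := Real.one_le_sqrt.2 (by linarith)
  obtain ⟨R, hR1, hR2⟩ := exists_radius hm (x := √n * Real.log n) (by nlinarith)
  have hR3 : (R : ℝ) ≤ 3 * Real.log n := radius_le hm h3 (by linarith) hR2
  have hfarR := hfar R hR1 hR2
  set A := regularGraphs (m + 1) n
  set P : SimpleGraph (Fin n) → Prop := fun G => G.Connected ∧
    maxVertexFlow G ≤ K * ((n : ℝ) * Real.logb d n ^ 3) + 0 with hP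
  have hgood : ∀ G ∈ A, (¬ ∃ a b, G.Far a b (2 * R)) → P G := fun G hG hnf => by
    have hw : ∀ a b, ∃ w : G.Walk a b, w.length ≤ 2 * R := fun a b => by
      by_contra h
      exact hnf ⟨a, b, h⟩
    have hne : Nonempty (Fin n) := ⟨⟨0, by exact_mod_cast hn0⟩⟩
    have hconn : G.Connected := ⟨fun a b => (hw a b).elim fun w _ => ⟨w⟩⟩
    refine ⟨hconn, ?_⟩
    have := maxVertexFlow_le hm hG hconn (D := 2 * R)
      fun a b => (hw a b).elim fun w hw => (SimpleGraph.dist_le w).trans hw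
    refine this.trans ?_
    have e1 : (m : ℝ) ^ (2 * R) ≤ m ^ 2 * (n * Real.log n ^ 2) := by
      calc (m : ℝ) ^ (2 * R) = (m ^ R) ^ 2 := by rw [mul_comm, pow_mul]
        _ ≤ (m * (√n * Real.log n)) ^ 2 := by gcongr
        _ = m ^ 2 * ((√n * √n) * Real.log n ^ 2) := by ring
        _ = _ := by rw [hsq]
    have e2 : 8 * (((2 * R : ℕ) : ℝ) + 1) ≤ 56 * Real.log n := by
      push_cast
      linarith
    calc 8 * (((2 * R : ℕ) : ℝ) + 1) * (m : ℝ) ^ (2 * R)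
        ≤ 56 * Real.log n * (m ^ 2 * (n * Real.log n ^ 2)) := by gcongr
      _ = K * ((n : ℝ) * Real.logb d n ^ 3) + 0 := by
        rw [hK, Real.logb]
        field_simp
        ring
  have hfin : A.Finite := Set.finite_of_ncard_pos hpos
  have hsplit : A.ncard ≤ {G ∈ A | P G}.ncard + {G ∈ A | ∃ a b, G.Far a b (2 * R)}.ncard := by
    refine (Set.ncard_le_ncard (fun G hG => ?_) ((hfin.subset (Set.sep_subset _ _)).union
      (hfin.subset (Set.sep_subset _ _)))).trans (Set.ncard_union_le _ _)
    by_cases h : ∃ a b, G.Far a b (2 * R)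
    · exact Or.inr ⟨hG, h⟩
    · exact Or.inl ⟨hG, hgood G hG h⟩
  have hle : {G ∈ A | P G}.ncard ≤ A.ncard := Set.ncard_le_ncard (Set.sep_subset _ _) hfin
  have hpos' : (0 : ℝ) < A.ncard := by exact_mod_cast hpos
  have hsplit' : (A.ncard : ℝ) ≤ {G ∈ A | P G}.ncard +
    {G ∈ A | ∃ a b, G.Far a b (2 * R)}.ncard := by exact_mod_cast hsplit
  have hle' : ({G ∈ A | P G}.ncard : ℝ) ≤ A.ncard := by exact_mod_cast hle
  change dist (({G ∈ A | P G}.ncard : ℝ) / A.ncard) 1 < ε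
  rw [Real.dist_eq, abs_lt]
  constructor
  · rw [lt_sub_iff_add_lt, lt_div_iff₀ hpos']
    nlinarith
  · rw [sub_lt_iff_lt_add, div_lt_iff₀ hpos']
    nlinarith

end Main
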